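/- Let $N\ge 1$ be an integer and let $0<\alpha<2$. For $g\in S(\mathbb R)$ write $\widehat g(\xi)=(2\pi)^{-1/2}\int_{\mathbb R}e^{-is\xi}g(s)\,ds$. Let $\psi$ be a Lemarié–Meyer mother wavelet: a real-valued function in the Schwartz class $S(\mathbb R)$ such that the support of $\widehat\psi$ is contained in $\{\xi\in\mathbb R: 2\pi/3\le|\xi|\le 8\pi/3\}$ and such that the functions $\psi_{j,k}(x)=2^{j/2}\psi(2^jx-k)$, $(j,k)\in\mathbb Z^2$, form an orthonormal basis of $L^2(\mathbb R)$. For $J=(j_1,\dots,j_N)$, $K=(k_1,\dots,k_N)\in\mathbb Z^N$ put $$\widehat\Psi_{\alpha,J,K}(\lambda)=\prod_{l=1}^N 2^{-j_l(\frac1\alpha-\frac12)}\,\widehat\psi_{j_l,k_l}(\lambda_l),\qquad \lambda\in\mathbb R^N .$$ Let $\widetilde M_\alpha$ be a complex-valued rotationally invariant $\alpha$-stable random measure on $\mathbb R^N$ with Lebesgue control measure, defined on a probability space $(\Omega,\mathcal F,\mathbb P)$; that is, an independently scattered, (almost surely) $\sigma$-additive random set function on the Borel sets $A$ of finite Lebesgue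 measure $|A|$ with $$\mathbb E\exp\big(i\,\mathrm{Re}(\overline\theta\,\widetilde M_\alpha(A))\big)=\exp(-|\theta|^\alpha|A|),\qquad\theta\in\mathbb C.$$ For $f\in L^\alpha(\mathbb R^N)$ the integral $\int f\,d\widetilde M_\alpha$ is the limit in probability of the integrals of simple functions (vanishing outside sets of finite measure) converging to $f$ in $L^\alpha(\mathbb R^N)$. Let $$\epsilon_{J,K}=\int_{\mathbb R^N}\overline{\widehat\Psi_{\alpha,J,K}(\lambda)}\,\widetilde M_\alpha(d\lambda),\qquad (J,K)\in\mathbb Z^N\times\mathbb Z^N .$$ Then there is an event $\Omega^*$ of probability $1$ such that for every $\eta>0$ there exists a random variable $C>0$ with the following property. (i) If $\alpha\in(0,1)$, then for every $\omega\in\Omega^*$ and all $(J,K)\in\mathbb Z^N\times\mathbb Z^N$, $$|\epsilon_{J,K}(\omega)|\le C(\omega)\prod_{l=1}^N(1+|j_l|)^{1/\alpha+\eta}.$$ (ii) If $\alpha\in[1,2)$, then for every $\omega\in\Omega^*$ and all $(J,K)\in\mathbb Z^N\times\mathbb Z^N$, $$|\epsilon_{J,K}(\omega)|\le C(\omega)\prod_{l=1}^N(1+|j_l|)^{1/\alpha+\eta}\sqrt{\log(2+|j_l|)}\,\sqrt{\log(2+|k_l|)}.$$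 -/

import Mathlib

open MeasureTheory ProbabilityTheory Filter
open scoped Topology SchwartzMap ComplexConjugate ENNReal

noncomputable section

namespace HFSS

/-- The unitary Fourier transform `(2π)^(-1/2) ∫ e^{-isξ} g(s) ds` on the real line. -/
def fourierU (g : ℝ → ℂ) (ξ : ℝ) : ℂ :=
  (((2 * Real.pi) ^ (-(1 / 2) : ℝ) : ℝ) : ℂ) *
    ∫ s : ℝ, Complex.exp (-(Complex.I * s * ξ)) * g s

/-- The dilated and translated wavelet `ψ_{j,k}(x) = 2^{j/2} ψ(2^j x - k)`, seen as a
complex-valued function. -/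
def psi (ψ : 𝓢(ℝ, ℝ)) (j k : ℤ) (x : ℝ) : ℂ :=
  (((2 : ℝ) ^ ((j : ℝ) / 2) * ψ ((2 : ℝ) ^ j * x - k) : ℝ) : ℂ)

/-- Lemarié–Meyer mother wavelets: real-valued Schwartz functions whose Fourier transform is
supported in the ring `2π/3 ≤ |ξ| ≤ 8π/3` and whose dyadic dilates and integer translates form
an orthonormal basis of `L²(ℝ)`. -/
structure IsLemarieMeyer (ψ : 𝓢(ℝ, ℝ)) : Prop where
  tsupport_subset : tsupport (fourierU fun x => (ψ x : ℂ)) ⊆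
    {ξ : ℝ | 2 * Real.pi / 3 ≤ |ξ| ∧ |ξ| ≤ 8 * Real.pi / 3}
  orthonormal_basis : ∃ b : HilbertBasis (ℤ × ℤ) ℂ (Lp ℂ 2 (volume : Measure ℝ)),
    ∀ j k : ℤ, (b (j, k) : ℝ → ℂ) =ᵐ[volume] psi ψ j k

/-- The renormalized Fourier transform
`2^{-j(1/α - 1/2)}` times the Fourier transform of `ψ_{j,k}`. -/
def hatPsi (α : ℝ) (ψ : 𝓢(ℝ, ℝ)) (j k : ℤ) (ξ : ℝ) : ℂ :=
  (((2 : ℝ) ^ (-(j : ℝ) * (1 / α - 1 / 2)) : ℝ) : ℂ) * fourierU (psi ψ j k) ξ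

/-- The tensor product `∏_l hatPsi_{α,j_l,k_l}(x_l)` on `ℝ^N`. -/
def hatPsiTensor {N : ℕ} (α : ℝ) (ψ : 𝓢(ℝ, ℝ)) (J K : Fin N → ℤ) (x : Fin N → ℝ) : ℂ :=
  ∏ l, hatPsi α ψ (J l) (K l) (x l)

/-- `M` is a complex-valued rotationally invariant `α`-stable random measure on `ℝ^N` with
Lebesgue control measure, on the probability space `(Ω, P)`: an independently scattered random
set function on the Borel sets of finite Lebesgue measure, almost surely countably additive along
each fixed disjoint sequence, such that `M A` is isotropic with
`E exp(i Re(conj θ * M A)) = exp(-|θ|^α |A|)`.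
The values of `M` on other sets are irrelevant. -/
structure IsStableRandomMeasure {N : ℕ} {Ω : Type*} [MeasurableSpace Ω] (α : ℝ) (P : Measure Ω)
    (M : Set (Fin N → ℝ) → Ω → ℂ) : Prop where
  measurable : ∀ A, MeasurableSet A → volume A < ∞ → Measurable (M A)
  indep : ∀ (n : ℕ) (A : Fin n → Set (Fin N → ℝ)), (∀ i, MeasurableSet (A i)) →
    (∀ i, volume (A i) < ∞) → Pairwise (Function.onFun Disjoint A) →
    iIndepFun (fun i => M (A i)) P
  sigma_additive : ∀ A : ℕ → Set (Fin N → ℝ), (∀ i, MeasurableSet (A i)) →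
    volume (⋃ i, A i) < ∞ → Pairwise (Function.onFun Disjoint A) →
    ∀ᵐ ω ∂P, Tendsto (fun n => ∑ i ∈ Finset.range n, M (A i) ω) atTop (𝓝 (M (⋃ i, A i) ω))
  charFun_eq : ∀ A, MeasurableSet A → volume A < ∞ → ∀ θ : ℂ,
    charFun (P.map (M A)) θ = ((Real.exp (-(‖θ‖ ^ α * volume.real A)) : ℝ) : ℂ)

/-- The integral `∑_z z M(f = z)` of a simple function. -/
def simpleIntegral {N : ℕ} {Ω : Type*} (M : Set (Fin N → ℝ) → Ω → ℂ)
    (f : SimpleFunc (Fin N → ℝ) ℂ) (ω : Ω) : ℂ :=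
  ∑ z ∈ f.range, z * M (f ⁻¹' {z}) ω

/-- The random variable `I` is (a version of) the stochastic integral of `f ∈ L^α(ℝ^N)` with
respect to `M`: the limit in probability of the integrals of simple functions, supported on sets
of finite measure, that converge to `f` in `L^α`. -/
structure IsStableIntegral {N : ℕ} {Ω : Type*} [MeasurableSpace Ω] (α : ℝ) (P : Measure Ω)
    (M : Set (Fin N → ℝ) → Ω → ℂ) (f : (Fin N → ℝ) → ℂ) (I : Ω → ℂ) : Prop where
  measurable : Measurable I
  memLp : MemLp f (ENNReal.ofReal α) volume
  exists_approx : ∃ g : ℕ → SimpleFunc (Fin N → ℝ) ℂ,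
    (∀ n, (g n).FinMeasSupp volume) ∧
    Tendsto (fun n => eLpNorm (fun x => g n x - f x) (ENNReal.ofReal α) volume) atTop (𝓝 0) ∧
    TendstoInMeasure P (fun n => simpleIntegral M (g n)) atTop I

end HFSS

end

namespace HFSS

/-! ### Tails of isotropic stable laws -/

/-! Translating a wavelet by `K` only multiplies its Fourier transform by a phase, so for fixed `J`
all the integrands share the envelope `h_J = |hatPsiTensor α ψ J 0|`, and the normalization makes `∫
h_J ^ α` independent of `J`. The core is therefore a maximal inequality for stable integrals under a
common envelope, uniform in the size of the family.

For simple functions it reduces to sums `∑ c_i M(A_i)` over common disjoint atoms (`exists_atoms`).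
Since `‖M(A_i)‖ ^ p` has tail index `α / p < 1`, truncation gives `∑ (‖c_i‖ ‖M(A_i)‖) ^ p` the tail
`y ^ (-α/p) ∫ h ^ α`. With `p = 1` (`α < 1`) this sum bounds every integral at once, so the supremum
over `K` costs nothing. With `p = 2`, random signs replace the independent symmetric `M(A_i)`: where
the sum of squares is at most `y`, Hoeffding's inequality gives the tail `exp(-t²/(8y))`, and the
union over `K` is paid for by the logarithms (`pi_measure_sum_gt_le`). Limits in probability and
increasing unions extend both bounds to countable families of stable integrals.

For the union over `J`, the weight `(1 + |j|) ^ (1/α + η)` turns the power tail into the summable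
`(1 + |j|) ^ (-(1 + αη))`. The total probability of exceeding `2x` times the weights tends to 0 as
`x → ∞`, which gives a finite random constant almost surely. -/

/-- Tail of a one-dimensional projection of an isotropic `α`-stable law on `ℂ`. -/
lemma measureReal_abs_inner_gt_le_of_charFun {μ : Measure ℂ} [IsProbabilityMeasure μ] {α s : ℝ}
    (hα : 0 < α) (hs : 0 ≤ s)
    (hμ : ∀ θ : ℂ, charFun μ θ = ((Real.exp (-(‖θ‖ ^ α * s)) : ℝ) : ℂ))
    {a : ℂ} (ha : ‖a‖ = 1) {r : ℝ} (hr : 0 < r) :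
    μ.real {z | r < |inner ℝ a z|} ≤ 2 * 2 ^ α * s * r ^ (-α) := by
  refine (measureReal_abs_inner_gt_le_integral_charFun hr).trans ?_
  have hle : (-2 * r⁻¹ : ℝ) ≤ 2 * r⁻¹ := by have := inv_pos.2 hr; linarith
  -- From `1 - exp(-u) ≤ u`, with `u` largest at the endpoints.
  have hb : ‖∫ t in (-2 * r⁻¹)..(2 * r⁻¹), 1 - charFun μ (t • a)‖
      ≤ ((2 * r⁻¹) ^ α * s) * |2 * r⁻¹ - -2 * r⁻¹| := by
    apply intervalIntegral.norm_integral_le_of_norm_le_const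
    intro t ht
    rw [Set.uIoc_of_le hle] at ht
    have habs : |t| ≤ 2 * r⁻¹ := abs_le.2 ⟨by linarith [ht.1], ht.2⟩
    rw [hμ, norm_smul, ha, mul_one, Real.norm_eq_abs, ← Complex.ofReal_one, ← Complex.ofReal_sub,
      Complex.norm_real, Real.norm_eq_abs]
    have h0 : 0 ≤ |t| ^ α * s := by positivity
    rw [abs_of_nonneg (by simpa using h0)]
    have h1 := Real.add_one_le_exp (-(|t| ^ α * s))
    have h2 : |t| ^ α * s ≤ (2 * r⁻¹) ^ α * s := by gcongr
    linarith
  have hr' : (r⁻¹) ^ α = r ^ (-α) := by rw [Real.rpow_neg hr.le, Real.inv_rpow hr.le]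
  calc 2⁻¹ * r * ‖∫ t in (-2 * r⁻¹)..(2 * r⁻¹), 1 - charFun μ (t • a)‖
      ≤ 2⁻¹ * r * (((2 * r⁻¹) ^ α * s) * |2 * r⁻¹ - -2 * r⁻¹|) := by gcongr
    _ = 2 * 2 ^ α * s * r ^ (-α) := by
        rw [abs_of_nonneg (by linarith), Real.mul_rpow (by norm_num) (by positivity), hr']
        field_simp
        ring

/-- Tail of the modulus of an isotropic `α`-stable law on `ℂ`. -/
lemma measure_norm_gt_le_of_charFun {μ : Measure ℂ} [IsProbabilityMeasure μ] {α s : ℝ}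
    (hα : 0 < α) (hs : 0 ≤ s)
    (hμ : ∀ θ : ℂ, charFun μ θ = ((Real.exp (-(‖θ‖ ^ α * s)) : ℝ) : ℂ)) {r : ℝ} (hr : 0 < r) :
    μ {z | r < ‖z‖} ≤ ENNReal.ofReal (4 * 4 ^ α * s * r ^ (-α)) := by
  have hsub : {z : ℂ | r < ‖z‖} ⊆
      {z | r / 2 < |inner ℝ (1 : ℂ) z|} ∪ {z | r / 2 < |inner ℝ Complex.I z|} := by
    intro z hz
    have h1 : inner ℝ (1 : ℂ) z = z.re := by simp [Complex.inner]
    have h2 : inner ℝ Complex.I z = z.im := by simp [Complex.inner]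
    simp only [Set.mem_union, Set.mem_ofPred_eq, h1, h2] at hz ⊢
    by_contra! h
    linarith [Complex.norm_le_abs_re_add_abs_im z]
  have hr2 : 0 < r / 2 := by positivity
  rw [← ofReal_measureReal]
  apply ENNReal.ofReal_le_ofReal
  refine (measureReal_mono hsub).trans ((measureReal_union_le _ _).trans ?_)
  have h1 := measureReal_abs_inner_gt_le_of_charFun hα hs hμ (a := 1) (by simp) hr2
  have h2 := measureReal_abs_inner_gt_le_of_charFun hα hs hμ (a := Complex.I) (by simp) hr2
  have h3 : (r / 2) ^ (-α) = 2 ^ α * r ^ (-α) := by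
    rw [Real.div_rpow hr.le (by norm_num), Real.rpow_neg (by norm_num : (0:ℝ) ≤ 2)]
    field_simp
  have h4 : (4 : ℝ) ^ α = 2 ^ α * 2 ^ α := by
    rw [← Real.mul_rpow (by norm_num) (by norm_num)]; norm_num
  rw [h3] at h1 h2
  rw [h4]
  linarith

/-- A law with even characteristic function is symmetric. -/
lemma map_neg_eq_of_charFun {μ : Measure ℂ} [IsFiniteMeasure μ]
    (hμ : ∀ θ : ℂ, charFun μ (-θ) = charFun μ θ) : μ.map (fun z => -z) = μ := by
  have : IsFiniteMeasure (μ.map (fun z => -z)) := inferInstance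
  apply Measure.ext_of_charFun
  ext θ
  have h := charFun_map_smul (μ := μ) (-1) θ
  simp only [neg_smul, one_smul] at h
  rw [h, hμ]

/-! ### Sums of nonnegative variables with heavy tails -/

/-- Layer-cake formula: truncation at `y` cuts the tail integral to `(0, y]`, and `β < 1` makes it
converge at 0. -/
lemma lintegral_min_le_of_tail {Ω : Type*} [MeasurableSpace Ω] {P : Measure Ω}
    {X : Ω → ℝ} (hX : Measurable X) (hX0 : ∀ ω, 0 ≤ X ω) {β B y : ℝ} (hβ1 : β < 1)
    (hB : 0 ≤ B) (hy : 0 < y)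
    (htail : ∀ u, 0 < u → P {ω | u < X ω} ≤ ENNReal.ofReal (B * u ^ (-β))) :
    ∫⁻ ω, ENNReal.ofReal (min (X ω) y) ∂P ≤ ENNReal.ofReal (B * (y ^ (1 - β) / (1 - β))) := by
  have hint : IntervalIntegrable (fun u : ℝ => B * u ^ (-β)) volume 0 y :=
    (intervalIntegral.intervalIntegrable_rpow' (by linarith)).const_mul B
  rw [lintegral_eq_lintegral_meas_lt P (ae_of_all _ fun ω => le_min (hX0 ω) hy.le)
    (hX.min measurable_const).aemeasurable]
  calc ∫⁻ u in Set.Ioi (0 : ℝ), P {ω | u < min (X ω) y}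
      ≤ ∫⁻ u in Set.Ioi (0 : ℝ), (Set.Ioc 0 y).indicator
          (fun u => ENNReal.ofReal (B * u ^ (-β))) u := by
        refine setLIntegral_mono' measurableSet_Ioi fun u hu => ?_
        by_cases huy : u ≤ y
        · rw [Set.indicator_of_mem (show u ∈ Set.Ioc 0 y from ⟨hu, huy⟩)]
          refine (measure_mono fun ω (hω : u < min (X ω) y) => ?_).trans (htail u hu)
          exact (lt_min_iff.1 hω).1
        · have : {ω | u < min (X ω) y} = ∅ := by
            ext ω; simp only [Set.mem_ofPred_eq, lt_min_iff, Set.mem_empty_iff_false, iff_false]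
            exact fun h => huy h.2.le
          rw [this]; simp
    _ = ∫⁻ u in Set.Ioc (0 : ℝ) y, ENNReal.ofReal (B * u ^ (-β)) := by
        rw [setLIntegral_indicator measurableSet_Ioc,
          Set.inter_eq_left.2 (fun u hu => hu.1)]
    _ = ENNReal.ofReal (∫ u in Set.Ioc (0 : ℝ) y, B * u ^ (-β)) := by
        rw [ofReal_integral_eq_lintegral_ofReal]
        · exact (intervalIntegrable_iff_integrableOn_Ioc_of_le hy.le).1 hint
        · refine (ae_restrict_iff' measurableSet_Ioc).2 (ae_of_all _ fun u hu => ?_)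
          have := hu.1
          positivity
    _ = ENNReal.ofReal (B * (y ^ (1 - β) / (1 - β))) := by
        rw [← intervalIntegral.integral_of_le hy.le, intervalIntegral.integral_const_mul,
          integral_rpow (Or.inl (by linarith))]
        rw [show -β + 1 = 1 - β by ring, Real.zero_rpow (by linarith), sub_zero]

/-- If finitely many nonnegative variables have tails `B i * u ^ (-β)` with `β < 1`, so has their
sum, up to a constant, with `B` the sum of the `B i`; no independence is needed. -/
lemma measure_sum_gt_le_of_tail {Ω ι : Type*} [MeasurableSpace Ω] {P : Measure Ω} [Fintype ι]
    {X : ι → Ω → ℝ} (hX : ∀ i, Measurable (X i)) (hX0 : ∀ i ω, 0 ≤ X i ω) {β y : ℝ}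
    {B : ι → ℝ} (hβ1 : β < 1) (hB : ∀ i, 0 ≤ B i) (hy : 0 < y)
    (htail : ∀ i u, 0 < u → P {ω | u < X i ω} ≤ ENNReal.ofReal (B i * u ^ (-β))) :
    P {ω | y < ∑ i, X i ω} ≤
      ENNReal.ofReal ((1 + 1 / (1 - β)) * y ^ (-β)) * ∑ i, ENNReal.ofReal (B i) := by
  have h1β : 0 < 1 - β := by linarith
  -- Either one term alone exceeds `y`, or the truncated terms already sum to `y`. A union bound
  -- treats the first case, Markov's inequality the second.
  have hsub : {ω | y < ∑ i, X i ω} ⊆ (⋃ i, {ω | y < X i ω}) ∪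
      {ω | ENNReal.ofReal y ≤ ∑ i, ENNReal.ofReal (min (X i ω) y)} := by
    intro ω hω
    by_cases h : ∃ i, y < X i ω
    · exact Or.inl (Set.mem_iUnion.2 h)
    · right
      push Not at h
      simp only [Set.mem_ofPred_eq] at hω ⊢
      simp_rw [min_eq_left (h _)]
      rw [← ENNReal.ofReal_sum_of_nonneg fun i _ => hX0 i ω]
      exact ENNReal.ofReal_le_ofReal hω.le
  have h1 : P (⋃ i, {ω | y < X i ω}) ≤ ENNReal.ofReal (y ^ (-β)) * ∑ i, ENNReal.ofReal (B i) := by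
    refine (measure_iUnion_fintype_le P _).trans ?_
    rw [Finset.mul_sum]
    refine Finset.sum_le_sum fun i _ => (htail i y hy).trans_eq ?_
    rw [mul_comm, ENNReal.ofReal_mul (by positivity)]
  have hmeas : ∀ i, Measurable fun ω => ENNReal.ofReal (min (X i ω) y) := fun i =>
    ((hX i).min measurable_const).ennreal_ofReal
  have h2 : P {ω | ENNReal.ofReal y ≤ ∑ i, ENNReal.ofReal (min (X i ω) y)} ≤
      ENNReal.ofReal (1 / (1 - β) * y ^ (-β)) * ∑ i, ENNReal.ofReal (B i) := by
    have hyne : ENNReal.ofReal y ≠ 0 := by simpa using hy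
    refine (meas_ge_le_lintegral_div
      (Finset.measurable_sum _ fun i _ => hmeas i).aemeasurable hyne ENNReal.ofReal_ne_top).trans ?_
    rw [lintegral_finsetSum _ fun i _ => hmeas i, ENNReal.div_eq_inv_mul, Finset.mul_sum,
      Finset.mul_sum]
    refine Finset.sum_le_sum fun i _ => ?_
    rw [← ENNReal.ofReal_inv_of_pos hy]
    refine (mul_le_mul_right (lintegral_min_le_of_tail (hX i) (hX0 i) hβ1 (hB i) hy
      (htail i)) _).trans_eq ?_
    rw [← ENNReal.ofReal_mul (by positivity), ← ENNReal.ofReal_mul (by positivity)]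
    congr 1
    rw [sub_eq_add_neg 1 β, Real.rpow_add hy, Real.rpow_one]
    field_simp
  refine (measure_mono hsub).trans ((measure_union_le _ _).trans ((add_le_add h1 h2).trans_eq ?_))
  rw [← add_mul, ← ENNReal.ofReal_add (by positivity) (by positivity)]
  congr 2
  ring

/-! ### Random signs -/

/-- The sign `±1` attached to a Boolean. -/
def sign (b : Bool) : ℝ := if b then 1 else -1

lemma abs_sign (b : Bool) : |sign b| = 1 := by cases b <;> simp [sign]

/-- The sum over sign vectors factors into terms `2 cosh(s a_i)`, and `cosh x ≤ exp(x²/2)`. -/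
lemma sum_exp_sign_le {n : Type*} [Fintype n] [DecidableEq n] (a : n → ℝ) (s : ℝ) :
    ∑ σ : n → Bool, Real.exp (s * ∑ i, sign (σ i) * a i)
      ≤ 2 ^ Fintype.card n * Real.exp (s ^ 2 * (∑ i, a i ^ 2) / 2) := by
  have h1 : ∀ σ : n → Bool, Real.exp (s * ∑ i, sign (σ i) * a i)
      = ∏ i, Real.exp (s * (sign (σ i) * a i)) := fun σ => by
    rw [Finset.mul_sum, Real.exp_sum]
  simp_rw [h1]
  have h2 := Finset.prod_univ_sum (fun _ : n => (Finset.univ : Finset Bool))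
    (fun i b => Real.exp (s * (sign b * a i)))
  rw [Fintype.piFinset_univ] at h2
  rw [← h2]
  have h3 : ∀ i, ∑ b : Bool, Real.exp (s * (sign b * a i)) ≤ 2 * Real.exp ((s * a i) ^ 2 / 2) := by
    intro i
    have := Real.cosh_le_exp_half_sq (s * a i)
    rw [Real.cosh_eq] at this
    simp only [Fintype.sum_bool, sign]
    simp only [if_true, Bool.false_eq_true, if_false, one_mul, neg_one_mul, mul_neg]
    linarith
  refine (Finset.prod_le_prod (fun i _ => by positivity) fun i _ => h3 i).trans_eq ?_
  rw [Finset.prod_mul_distrib, ← Real.exp_sum, Finset.prod_const, Finset.card_univ]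
  congr 2
  rw [Finset.mul_sum, Finset.sum_div]
  exact Finset.sum_congr rfl fun i _ => by ring

lemma card_sign_sum_gt_le {n : Type*} [Fintype n] [DecidableEq n] (a : n → ℝ) {y t : ℝ}
    (hy : 0 < y) (hay : ∑ i, a i ^ 2 ≤ y) (ht : 0 ≤ t) :
    ((Finset.univ.filter fun σ : n → Bool => t < ∑ i, sign (σ i) * a i).card : ℝ)
      ≤ 2 ^ Fintype.card n * Real.exp (-(t ^ 2 / (2 * y))) := by
  -- This `s` minimizes the Chernoff exponent `s²y/2 - st`; the minimum is `-t²/(2y)`.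
  set s := t / y with hs
  have hs0 : 0 ≤ s := by positivity
  have key : ((Finset.univ.filter fun σ : n → Bool => t < ∑ i, sign (σ i) * a i).card : ℝ)
      * Real.exp (s * t) ≤ 2 ^ Fintype.card n * Real.exp (s ^ 2 * y / 2) := by
    rw [← nsmul_eq_mul, ← Finset.sum_const]
    calc _ ≤ ∑ σ ∈ Finset.univ.filter fun σ : n → Bool => t < ∑ i, sign (σ i) * a i,
          Real.exp (s * ∑ i, sign (σ i) * a i) := by
          refine Finset.sum_le_sum fun σ hσ => ?_
          have := (Finset.mem_filter.1 hσ).2.le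
          gcongr
      _ ≤ ∑ σ : n → Bool, Real.exp (s * ∑ i, sign (σ i) * a i) :=
          Finset.sum_le_sum_of_subset_of_nonneg (Finset.filter_subset _ _)
            fun _ _ _ => by positivity
      _ ≤ _ := sum_exp_sign_le a s
      _ ≤ _ := by gcongr
  rw [← le_div_iff₀ (by positivity), mul_div_assoc, ← Real.exp_sub] at key
  refine key.trans_eq ?_
  congr 2
  rw [hs]; field_simp; ring

lemma card_abs_sign_sum_gt_le {n : Type*} [Fintype n] [DecidableEq n] (a : n → ℝ) {y t : ℝ}
    (hy : 0 < y) (hay : ∑ i, a i ^ 2 ≤ y) (ht : 0 ≤ t) :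
    ((Finset.univ.filter fun σ : n → Bool => t < |∑ i, sign (σ i) * a i|).card : ℝ)
      ≤ 2 ^ Fintype.card n * (2 * Real.exp (-(t ^ 2 / (2 * y)))) := by
  have h1 := card_sign_sum_gt_le a hy hay ht
  have h2 := card_sign_sum_gt_le (fun i => -a i) hy (by simpa using hay) ht
  have hsub : (Finset.univ.filter fun σ : n → Bool => t < |∑ i, sign (σ i) * a i|) ⊆
      (Finset.univ.filter fun σ : n → Bool => t < ∑ i, sign (σ i) * a i) ∪
      (Finset.univ.filter fun σ : n → Bool => t < ∑ i, sign (σ i) * -a i) := by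
    intro σ hσ
    simpa [lt_abs] using hσ
  have h3 := (Finset.card_le_card hsub).trans (Finset.card_union_le _ _)
  have h3' : ((Finset.univ.filter fun σ : n → Bool => t < |∑ i, sign (σ i) * a i|).card : ℝ) ≤
      (Finset.univ.filter fun σ : n → Bool => t < ∑ i, sign (σ i) * a i).card +
      (Finset.univ.filter fun σ : n → Bool => t < ∑ i, sign (σ i) * -a i).card := by
    exact_mod_cast h3
  linarith

/-- Hoeffding's inequality for random signs with complex coefficients. -/
lemma card_norm_sign_sum_gt_le {n : Type*} [Fintype n] [DecidableEq n] (a : n → ℂ) {y t : ℝ}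
    (hy : 0 < y) (hay : ∑ i, ‖a i‖ ^ 2 ≤ y) (ht : 0 ≤ t) :
    ((Finset.univ.filter fun σ : n → Bool => t < ‖∑ i, (sign (σ i) : ℂ) * a i‖).card : ℝ)
      ≤ 2 ^ Fintype.card n * (4 * Real.exp (-(t ^ 2 / (8 * y)))) := by
  have hre : ∑ i, (a i).re ^ 2 ≤ y := (Finset.sum_le_sum fun i _ => by
    rw [← sq_abs (a i).re]; gcongr; exact Complex.abs_re_le_norm _).trans hay
  have him : ∑ i, (a i).im ^ 2 ≤ y := (Finset.sum_le_sum fun i _ => by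
    rw [← sq_abs (a i).im]; gcongr; exact Complex.abs_im_le_norm _).trans hay
  have h1 := card_abs_sign_sum_gt_le (fun i => (a i).re) hy hre (t := t / 2) (by positivity)
  have h2 := card_abs_sign_sum_gt_le (fun i => (a i).im) hy him (t := t / 2) (by positivity)
  have hsub : (Finset.univ.filter fun σ : n → Bool => t < ‖∑ i, (sign (σ i) : ℂ) * a i‖) ⊆
      (Finset.univ.filter fun σ : n → Bool => t / 2 < |∑ i, sign (σ i) * (a i).re|) ∪
      (Finset.univ.filter fun σ : n → Bool => t / 2 < |∑ i, sign (σ i) * (a i).im|) := by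
    intro σ hσ
    simp only [Finset.mem_union, Finset.mem_filter, Finset.mem_univ, true_and] at hσ ⊢
    have h := Complex.norm_le_abs_re_add_abs_im (∑ i, (sign (σ i) : ℂ) * a i)
    simp only [Complex.re_sum, Complex.im_sum, Complex.re_ofReal_mul, Complex.im_ofReal_mul] at h
    by_contra! hc
    linarith
  have h3 := (Finset.card_le_card hsub).trans (Finset.card_union_le _ _)
  have h3' : ((Finset.univ.filter fun σ : n → Bool =>
        t < ‖∑ i, (sign (σ i) : ℂ) * a i‖).card : ℝ) ≤
      (Finset.univ.filter fun σ : n → Bool => t / 2 < |∑ i, sign (σ i) * (a i).re|).card +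
      (Finset.univ.filter fun σ : n → Bool => t / 2 < |∑ i, sign (σ i) * (a i).im|).card := by
    exact_mod_cast h3
  have h4 : (t / 2) ^ 2 / (2 * y) = t ^ 2 / (8 * y) := by field_simp; ring
  rw [h4] at h1 h2
  linarith

/-! ### Symmetrization of linear combinations of independent symmetric variables -/

lemma map_sign_mul_pi {n : Type*} [Fintype n] (μ : n → Measure ℂ)
    [∀ i, IsProbabilityMeasure (μ i)] (hμ : ∀ i, (μ i).map (fun z => -z) = μ i) (σ : n → Bool) :
    (Measure.pi μ).map (fun m i => (sign (σ i) : ℂ) * m i) = Measure.pi μ := by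
  have h : ∀ i, (μ i).map (fun z => (sign (σ i) : ℂ) * z) = μ i := by
    intro i
    cases hσ : σ i
    · simpa [sign] using hμ i
    · simp [sign]
  have : ∀ i, SigmaFinite ((μ i).map (fun z => (sign (σ i) : ℂ) * z)) := by
    intro i; rw [h i]; infer_instance
  rw [Measure.pi_map_pi (f := fun i z => (sign (σ i) : ℂ) * z)
    fun i => (measurable_const_mul _).aemeasurable]
  simp_rw [h]

/-- On the event that the sum of squares is at most `y`, a linear combination of independent
symmetric variables has Gaussian tails. -/
lemma pi_measure_sum_gt_le {n : Type*} [Fintype n] (μ : n → Measure ℂ)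
    [∀ i, IsProbabilityMeasure (μ i)] (hμ : ∀ i, (μ i).map (fun z => -z) = μ i)
    (c : n → ℂ) {y t : ℝ} (hy : 0 < y) (ht : 0 ≤ t) :
    Measure.pi μ {m | ∑ i, ‖c i * m i‖ ^ 2 ≤ y ∧ t < ‖∑ i, c i * m i‖} ≤
      ENNReal.ofReal (4 * Real.exp (-(t ^ 2 / (8 * y)))) := by
  classical
  set E : Set (n → ℂ) := {m | ∑ i, ‖c i * m i‖ ^ 2 ≤ y ∧ t < ‖∑ i, c i * m i‖} with hE
  set b : ℝ := 4 * Real.exp (-(t ^ 2 / (8 * y))) with hb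
  have hEm : MeasurableSet E := by
    rw [hE, Set.ofPred_and]
    exact (measurableSet_le (by fun_prop) measurable_const).inter
      (measurableSet_lt measurable_const (by fun_prop))
  have hflip : ∀ σ : n → Bool, Measurable fun (m : n → ℂ) i => (sign (σ i) : ℂ) * m i :=
    fun σ => by fun_prop
  -- Each flip preserves the product law, so the measure of `E` equals its average over all flips.
  -- The constraint on squares ignores signs, so for fixed `m` only sign vectors remain to be
  -- counted.
  have hinv : ∀ σ : n → Bool,
      ∫⁻ m, E.indicator 1 (fun i => (sign (σ i) : ℂ) * m i) ∂Measure.pi μ = Measure.pi μ E := by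
    intro σ
    rw [← lintegral_map (f := E.indicator (1 : (n → ℂ) → ℝ≥0∞)) (measurable_one.indicator hEm)
      (hflip σ), map_sign_mul_pi μ hμ σ, lintegral_indicator_one hEm]
  have hpt : ∀ m : n → ℂ, ∑ σ : n → Bool,
      E.indicator (1 : (n → ℂ) → ℝ≥0∞) (fun i => (sign (σ i) : ℂ) * m i) ≤
        ENNReal.ofReal (2 ^ Fintype.card n * b) := by
    intro m
    have hcard : ∑ σ : n → Bool,
        E.indicator (1 : (n → ℂ) → ℝ≥0∞) (fun i => (sign (σ i) : ℂ) * m i) =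
        ((Finset.univ.filter fun σ : n → Bool =>
          (fun i => (sign (σ i) : ℂ) * m i) ∈ E).card : ℝ≥0∞) := by
      rw [Finset.card_filter]
      push_cast
      exact Finset.sum_congr rfl fun σ _ => by simp [Set.indicator_apply]
    rw [hcard, ← ENNReal.ofReal_natCast]
    apply ENNReal.ofReal_le_ofReal
    have hnorm : ∀ (σ : n → Bool) i, ‖c i * ((sign (σ i) : ℂ) * m i)‖ = ‖c i * m i‖ := by
      intro σ i
      simp [abs_sign]
    by_cases hm : ∑ i, ‖c i * m i‖ ^ 2 ≤ y
    · refine le_trans ?_ (card_norm_sign_sum_gt_le (fun i => c i * m i) hy hm ht)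
      have : (Finset.univ.filter fun σ : n → Bool => (fun i => (sign (σ i) : ℂ) * m i) ∈ E) ⊆
          Finset.univ.filter fun σ : n → Bool => t < ‖∑ i, (sign (σ i) : ℂ) * (c i * m i)‖ := by
        intro σ hσ
        have h2 := (Finset.mem_filter.1 hσ).2.2
        refine Finset.mem_filter.2 ⟨Finset.mem_univ _, h2.trans_eq ?_⟩
        congr 1
        exact Finset.sum_congr rfl fun i _ => by ring
      exact_mod_cast Finset.card_le_card this
    · have : (Finset.univ.filter fun σ : n → Bool =>
          (fun i => (sign (σ i) : ℂ) * m i) ∈ E) = ∅ := by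
        refine Finset.filter_eq_empty_iff.2 fun σ _ hσ => hm ?_
        have := hσ.1
        simpa only [hnorm] using this
      rw [this]
      simp only [Finset.card_empty, Nat.cast_zero]
      positivity
  have hsum : (2 ^ Fintype.card n : ℝ≥0∞) * Measure.pi μ E ≤
      (2 ^ Fintype.card n : ℝ≥0∞) * ENNReal.ofReal b := by
    calc (2 ^ Fintype.card n : ℝ≥0∞) * Measure.pi μ E
        = ∑ σ : n → Bool,
            ∫⁻ m, E.indicator 1 (fun i => (sign (σ i) : ℂ) * m i) ∂Measure.pi μ := by
          simp_rw [hinv]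
          simp
      _ = ∫⁻ m, ∑ σ : n → Bool,
            E.indicator 1 (fun i => (sign (σ i) : ℂ) * m i) ∂Measure.pi μ := by
          rw [lintegral_finsetSum]
          exact fun σ _ => (measurable_one.indicator hEm).comp (hflip σ)
      _ ≤ ∫⁻ _, ENNReal.ofReal (2 ^ Fintype.card n * b) ∂Measure.pi μ := lintegral_mono hpt
      _ = _ := by
          rw [lintegral_const, measure_univ, mul_one, ENNReal.ofReal_mul (by positivity),
            ENNReal.ofReal_pow (by norm_num)]
          simp
  exact (ENNReal.mul_le_mul_iff_right (by simp) (by simp)).1 hsum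

/-! ### Stable random measures -/

section RandomMeasure

variable {N : ℕ} {Ω : Type*} [MeasurableSpace Ω] {α : ℝ} {P : Measure Ω}
  {M : Set (Fin N → ℝ) → Ω → ℂ}

lemma IsStableRandomMeasure.measure_norm_gt_le [IsProbabilityMeasure P]
    (hM : IsStableRandomMeasure α P M) (hα : 0 < α) {A : Set (Fin N → ℝ)} (hA : MeasurableSet A)
    (hAv : volume A < ∞) {r : ℝ} (hr : 0 < r) :
    P {ω | r < ‖M A ω‖} ≤ ENNReal.ofReal (4 * 4 ^ α * volume.real A * r ^ (-α)) := by
  have hm := hM.measurable A hA hAv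
  have : IsProbabilityMeasure (P.map (M A)) := Measure.isProbabilityMeasure_map hm.aemeasurable
  have h := measure_norm_gt_le_of_charFun hα measureReal_nonneg (hM.charFun_eq A hA hAv) hr
  rwa [Measure.map_apply hm (measurableSet_lt measurable_const measurable_norm)] at h

lemma IsStableRandomMeasure.map_neg [IsProbabilityMeasure P]
    (hM : IsStableRandomMeasure α P M) {A : Set (Fin N → ℝ)} (hA : MeasurableSet A)
    (hAv : volume A < ∞) : (P.map (M A)).map (fun z => -z) = P.map (M A) := by
  have : IsProbabilityMeasure (P.map (M A)) :=
    Measure.isProbabilityMeasure_map (hM.measurable A hA hAv).aemeasurable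
  apply map_neg_eq_of_charFun
  intro θ
  rw [hM.charFun_eq A hA hAv, hM.charFun_eq A hA hAv, norm_neg]

/-- For the constant sequence `∅` the partial sums `n * M ∅` converge, so their increments `M ∅`
tend to 0. -/
lemma IsStableRandomMeasure.empty (hM : IsStableRandomMeasure α P M) : ∀ᵐ ω ∂P, M ∅ ω = 0 := by
  have h := hM.sigma_additive (fun _ => ∅) (fun _ => MeasurableSet.empty) (by simp)
    (fun _ _ _ => disjoint_bot_left)
  filter_upwards [h] with ω hω
  simp only [Finset.sum_const, Finset.card_range, Set.iUnion_empty] at hω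
  have h1 := (hω.comp (tendsto_add_atTop_nat 1)).sub hω
  rw [sub_self] at h1
  refine tendsto_nhds_unique (tendsto_const_nhds.congr fun n => ?_) h1
  simp [Function.comp, add_smul]

lemma IsStableRandomMeasure.finset_additive (hM : IsStableRandomMeasure α P M) {ι : Type*}
    (s : Finset ι) (A : ι → Set (Fin N → ℝ)) (hA : ∀ i ∈ s, MeasurableSet (A i))
    (hAv : ∀ i ∈ s, volume (A i) < ∞) (hd : (s : Set ι).PairwiseDisjoint A) :
    ∀ᵐ ω ∂P, M (⋃ i ∈ s, A i) ω = ∑ i ∈ s, M (A i) ω := by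
  classical
  induction s using Finset.induction_on with
  | empty => simpa using hM.empty
  | insert a s ha ih =>
    have ih' := ih (fun i hi => hA i (Finset.mem_insert_of_mem hi))
      (fun i hi => hAv i (Finset.mem_insert_of_mem hi))
      (hd.subset (by simp))
    set U := ⋃ i ∈ s, A i with hU
    have hUm : MeasurableSet U := Finset.measurableSet_biUnion s
      fun i hi => hA i (Finset.mem_insert_of_mem hi)
    have hUv : volume U < ∞ := by
      refine (measure_biUnion_finset_le s A).trans_lt (ENNReal.sum_lt_top.2
        fun i hi => hAv i (Finset.mem_insert_of_mem hi))
    have hdisj : Disjoint (A a) U := by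
      rw [hU, Set.disjoint_iUnion₂_right]
      intro i hi
      refine hd (by simp) (by simp [hi]) ?_
      rintro rfl; exact ha hi
    have hU' : (⋃ i ∈ insert a s, A i) = A a ∪ U := by simp [hU]
    -- Additivity on two sets is countable additivity padded with empty sets.
    let B : ℕ → Set (Fin N → ℝ) := fun k => if k = 0 then A a else if k = 1 then U else ∅
    have hBU : ⋃ k, B k = A a ∪ U := by
      ext x
      simp only [Set.mem_iUnion, Set.mem_union]
      constructor
      · rintro ⟨k, hk⟩
        rcases k with _ | _ | k <;> simp [B] at hk <;> tauto
      · rintro (h | h)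
        · exact ⟨0, by simpa [B] using h⟩
        · exact ⟨1, by simpa [B] using h⟩
    have hadd := hM.sigma_additive B
      (by
        intro k
        rcases k with _ | _ | k
        · simpa [B] using hA a (by simp)
        · simpa [B] using hUm
        · simp [B])
      (by
        rw [hBU]
        exact (measure_union_le _ _).trans_lt (ENNReal.add_lt_top.2 ⟨hAv a (by simp), hUv⟩))
      (by
        intro k l hkl
        rcases k with _ | _ | k <;> rcases l with _ | _ | l <;>
          simp [B, Function.onFun, hdisj, hdisj.symm] at hkl ⊢)
    rw [hBU] at hadd
    filter_upwards [hadd, ih', hM.empty] with ω h1 h2 h3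
    rw [hU', Finset.sum_insert ha, ← h2]
    refine tendsto_nhds_unique h1 (tendsto_const_nhds.congr' ?_)
    filter_upwards [eventually_ge_atTop 2] with n hn
    obtain ⟨k, rfl⟩ := Nat.exists_eq_add_of_le hn
    rw [Finset.sum_range_add, Finset.sum_range_succ, Finset.sum_range_succ, Finset.sum_range_zero]
    simp [B, h3, show ∀ x, 2 + x ≠ 1 by omega]

/-- Finitely many simple functions, gathered into one simple function with values in a product. -/
def simplePi {X ι : Type*} [MeasurableSpace X] [Finite ι] (g : ι → SimpleFunc X ℂ) :
    SimpleFunc X (ι → ℂ) where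
  toFun x k := g k x
  measurableSet_fiber' v := by
    have : (fun x k => g k x) ⁻¹' {v} = ⋂ k, g k ⁻¹' {v k} := by
      ext x; simp [funext_iff]
    rw [this]
    exact MeasurableSet.iInter fun k => (g k).measurableSet_fiber _
  finite_range' := by
    refine (Set.Finite.pi' fun k => (g k).finite_range).subset ?_
    rintro _ ⟨x, rfl⟩ k
    exact ⟨x, rfl⟩

/-- The integrals of finitely many simple functions are linear combinations of the values of the
random measure on common disjoint sets. -/
lemma IsStableRandomMeasure.exists_atoms (hM : IsStableRandomMeasure α P M) (hα : 0 < α)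
    {ι : Type*} [Fintype ι] (g : ι → SimpleFunc (Fin N → ℝ) ℂ)
    (hg : ∀ k, (g k).FinMeasSupp volume) :
    ∃ (n : ℕ) (A : Fin n → Set (Fin N → ℝ)) (c : Fin n → ι → ℂ),
      (∀ i, MeasurableSet (A i)) ∧ (∀ i, volume (A i) < ∞) ∧
      Pairwise (Function.onFun Disjoint A) ∧
      (∀ k, ∀ᵐ ω ∂P, simpleIntegral M (g k) ω = ∑ i, c i k * M (A i) ω) ∧
      ∑ i, ENNReal.ofReal (‖c i‖ ^ α * volume.real (A i)) ≤
        ∫⁻ x, ‖(fun k => g k x : ι → ℂ)‖ₑ ^ α := by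
  classical
  set G := simplePi g with hG
  -- The fibre over 0 may have infinite measure; it contributes nothing to the integrals.
  set R := G.range.filter (· ≠ 0) with hR
  have hfin : ∀ v ∈ R, volume (G ⁻¹' {v}) < ∞ := by
    intro v hv
    obtain ⟨k, hk⟩ := Function.ne_iff.1 (Finset.mem_filter.1 hv).2
    refine (measure_mono ?_).trans_lt (SimpleFunc.finMeasSupp_iff.1 (hg k) (v k) hk)
    intro x hx
    exact congrFun hx k
  have hdisj : ∀ v w : ι → ℂ, v ≠ w → Disjoint (G ⁻¹' {v}) (G ⁻¹' {w}) := fun v w hvw =>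
    Disjoint.preimage _ (by simpa using hvw)
  let e := R.equivFin
  refine ⟨R.card, fun i => G ⁻¹' {(e.symm i : ι → ℂ)}, fun i => e.symm i,
    fun i => G.measurableSet_fiber _, fun i => hfin _ (e.symm i).2, ?_, ?_, ?_⟩
  · intro i j hij
    exact hdisj _ _ fun h => hij (e.symm.injective (Subtype.ext h))
  · intro k
    have hz : ∀ z ∈ (g k).range, ∀ᵐ ω ∂P, z * M (g k ⁻¹' {z}) ω =
        z * ∑ v ∈ R with v k = z, M (G ⁻¹' {v}) ω := by
      intro z _
      by_cases hz0 : z = 0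
      · simp [hz0]
      have hU : g k ⁻¹' {z} = ⋃ v ∈ R.filter (fun v => v k = z), G ⁻¹' {v} := by
        ext x
        simp only [Set.mem_preimage, Set.mem_singleton_iff, Set.mem_iUnion, exists_prop,
          Finset.mem_filter, hR]
        constructor
        · intro hx
          refine ⟨G x, ⟨⟨G.mem_range_self x, fun h => hz0 ?_⟩, hx⟩, rfl⟩
          rw [← hx]; exact congrFun h k
        · rintro ⟨v, ⟨_, hv⟩, hx⟩
          rw [← hv, ← hx]; rfl
      filter_upwards [hM.finset_additive (R.filter fun v => v k = z) (fun v => G ⁻¹' {v})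
        (fun v _ => G.measurableSet_fiber _) (fun v hv => hfin v (Finset.mem_filter.1 hv).1)
        (fun v _ w _ hvw => hdisj v w hvw)] with ω hω
      rw [hU, hω]
    have hall : ∀ᵐ ω ∂P, ∀ z ∈ (g k).range, z * M (g k ⁻¹' {z}) ω =
        z * ∑ v ∈ R with v k = z, M (G ⁻¹' {v}) ω :=
      (Finset.eventually_all _).2 hz
    filter_upwards [hall] with ω hω
    rw [simpleIntegral, Finset.sum_congr rfl hω]
    have h1 : ∀ z, z * ∑ v ∈ R with v k = z, M (G ⁻¹' {v}) ω =
        ∑ v ∈ R with v k = z, v k * M (G ⁻¹' {v}) ω := fun z => by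
      rw [Finset.mul_sum]
      exact Finset.sum_congr rfl fun v hv => by rw [(Finset.mem_filter.1 hv).2]
    simp_rw [h1]
    rw [Finset.sum_fiberwise_of_maps_to (g := fun v : ι → ℂ => v k)]
    · rw [← Finset.sum_coe_sort, ← e.symm.sum_comp]
    · intro v hv
      obtain ⟨x, rfl⟩ := SimpleFunc.mem_range.1 (Finset.mem_filter.1 hv).1
      exact (g k).mem_range_self x
  · have h1 : ∫⁻ x, ‖(fun k => g k x : ι → ℂ)‖ₑ ^ α =
        ∑ v ∈ G.range, ‖v‖ₑ ^ α * volume (G ⁻¹' {v}) := by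
      rw [← SimpleFunc.map_lintegral (fun v : ι → ℂ => ‖v‖ₑ ^ α) G,
        ← SimpleFunc.lintegral_eq_lintegral]
      rfl
    rw [h1]
    refine le_trans (le_of_eq ?_) (Finset.sum_le_sum_of_subset (Finset.filter_subset (· ≠ 0) _))
    rw [← hR, ← Finset.sum_coe_sort R, ← e.symm.sum_comp]
    refine Finset.sum_congr rfl fun i _ => ?_
    rw [ENNReal.ofReal_mul (by positivity), ofReal_measureReal (hfin _ (e.symm i).2).ne,
      ← ENNReal.ofReal_rpow_of_nonneg (norm_nonneg _) hα.le, ofReal_norm]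

end RandomMeasure

/-! ### Maximal inequalities for finite families -/

section RandomMeasure

variable {N : ℕ} {Ω : Type*} [MeasurableSpace Ω] {α : ℝ} {P : Measure Ω}
  {M : Set (Fin N → ℝ) → Ω → ℂ}

/-- The constant in the tail estimate for `∑ (c i * ‖M (A i)‖) ^ p`. -/
noncomputable def tailConst (α p : ℝ) : ℝ := 4 * 4 ^ α * (1 + 1 / (1 - α / p))

/-- Raising to the power `p` divides the tail index by `p`, and `α / p < 1` is what the summation of
tails requires. Used with `p = 1` and `p = 2`. -/
lemma IsStableRandomMeasure.measure_sum_rpow_gt_le [IsProbabilityMeasure P]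
    (hM : IsStableRandomMeasure α P M) (hα : 0 < α) {p : ℝ} (hp : α < p) {n : ℕ}
    {A : Fin n → Set (Fin N → ℝ)} (hA : ∀ i, MeasurableSet (A i)) (hAv : ∀ i, volume (A i) < ∞)
    {c : Fin n → ℝ} (hc : ∀ i, 0 ≤ c i) {y : ℝ} (hy : 0 < y) :
    P {ω | y < ∑ i, (c i * ‖M (A i) ω‖) ^ p} ≤ ENNReal.ofReal (tailConst α p * y ^ (-(α / p))) *
      ∑ i, ENNReal.ofReal (c i ^ α * volume.real (A i)) := by
  have hp0 : 0 < p := hα.trans hp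
  have hβ : α / p < 1 := (div_lt_one hp0).2 hp
  have hMm : ∀ i, Measurable (M (A i)) := fun i => hM.measurable _ (hA i) (hAv i)
  refine (measure_sum_gt_le_of_tail (P := P) (X := fun i ω => (c i * ‖M (A i) ω‖) ^ p)
    (B := fun i => 4 * 4 ^ α * (c i ^ α * volume.real (A i))) (β := α / p)
    (fun i => ((hMm i).norm.const_mul _).pow_const _)
    (fun i ω => by have := hc i; positivity) hβ
    (fun i => by have := hc i; positivity) hy ?_).trans_eq ?_
  · intro i u hu
    rcases (hc i).eq_or_lt with h0 | h0
    · have : {ω | u < (c i * ‖M (A i) ω‖) ^ p} = ∅ := by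
        ext ω
        simp [← h0, Real.zero_rpow hp0.ne', hu.le]
      rw [this]; simp
    · have hset : {ω | u < (c i * ‖M (A i) ω‖) ^ p} = {ω | u ^ p⁻¹ / c i < ‖M (A i) ω‖} := by
        ext ω
        simp only [Set.mem_ofPred_eq]
        rw [div_lt_iff₀' h0, Real.rpow_inv_lt_iff_of_pos hu.le (by positivity) hp0]
      rw [hset]
      refine (hM.measure_norm_gt_le hα (hA i) (hAv i) (by positivity)).trans_eq ?_
      congr 1
      rw [Real.div_rpow (by positivity) h0.le, ← Real.rpow_mul hu.le, Real.rpow_neg h0.le,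
        show p⁻¹ * -α = -(α / p) by rw [div_eq_mul_inv]; ring]
      field_simp
  · simp_rw [ENNReal.ofReal_mul (show (0 : ℝ) ≤ 4 * 4 ^ α by positivity)]
    rw [← Finset.mul_sum, ← mul_assoc, ← ENNReal.ofReal_mul' (by positivity)]
    congr 2
    rw [tailConst]; ring

/-- Maximal inequality for simple functions, without symmetrization. -/
lemma IsStableRandomMeasure.measure_exists_simpleIntegral_gt_le_of_lt_one
    [IsProbabilityMeasure P] (hM : IsStableRandomMeasure α P M) (hα : 0 < α) (hα1 : α < 1)
    {ι : Type*} [Fintype ι] (g : ι → SimpleFunc (Fin N → ℝ) ℂ)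
    (hg : ∀ k, (g k).FinMeasSupp volume) {t : ℝ} (ht : 0 < t) :
    P {ω | ∃ k, t < ‖simpleIntegral M (g k) ω‖} ≤ ENNReal.ofReal (tailConst α 1 * t ^ (-α)) *
      ∫⁻ x, ‖(fun k => g k x : ι → ℂ)‖ₑ ^ α := by
  obtain ⟨n, A, c, hA, hAv, -, hI, hS⟩ := hM.exists_atoms hα g hg
  -- `‖c i‖` is the sup norm over the family, so one sum dominates all its members and no union
  -- bound is needed.
  have h := hM.measure_sum_rpow_gt_le hα hα1 hA hAv (c := fun i => ‖c i‖)
    (fun i => norm_nonneg _) ht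
  rw [div_one] at h
  refine le_trans (measure_mono_ae ?_) (h.trans (by gcongr))
  filter_upwards [ae_all_iff.2 hI] with ω hω
  rintro ⟨k, hk⟩
  change t < ∑ i, (‖c i‖ * ‖M (A i) ω‖) ^ (1 : ℝ)
  refine hk.trans_le ?_
  rw [hω k]
  refine (norm_sum_le _ _).trans (Finset.sum_le_sum fun i _ => ?_)
  rw [Real.rpow_one, norm_mul]
  gcongr
  exact norm_le_pi_norm (c i) k

/-- Maximal inequality for simple functions, by symmetrization. -/
lemma IsStableRandomMeasure.measure_exists_simpleIntegral_gt_le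
    [IsProbabilityMeasure P] (hM : IsStableRandomMeasure α P M) (hα : 0 < α) (hα2 : α < 2)
    {ι : Type*} [Fintype ι] (g : ι → SimpleFunc (Fin N → ℝ) ℂ)
    (hg : ∀ k, (g k).FinMeasSupp volume) {y : ℝ} (hy : 0 < y) {t : ι → ℝ} (ht : ∀ k, 0 ≤ t k) :
    P {ω | ∃ k, t k < ‖simpleIntegral M (g k) ω‖} ≤
      ENNReal.ofReal (tailConst α 2 * y ^ (-(α / 2))) *
        (∫⁻ x, ‖(fun k => g k x : ι → ℂ)‖ₑ ^ α) +
      ∑ k, ENNReal.ofReal (4 * Real.exp (-(t k ^ 2 / (8 * y)))) := by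
  obtain ⟨n, A, c, hA, hAv, hd, hI, hS⟩ := hM.exists_atoms hα g hg
  have h := hM.measure_sum_rpow_gt_le hα hα2 hA hAv (c := fun i => ‖c i‖)
    (fun i => norm_nonneg _) hy
  have hMm : ∀ i, Measurable (M (A i)) := fun i => hM.measurable _ (hA i) (hAv i)
  have hprob : ∀ i, IsProbabilityMeasure (P.map (M (A i))) := fun i =>
    Measure.isProbabilityMeasure_map (hMm i).aemeasurable
  have hlaw := (iIndepFun_iff_map_fun_eq_pi_map fun i => (hMm i).aemeasurable).1
    (hM.indep n A hA hAv hd)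
  have hk : ∀ k, P {ω | ∑ i, ‖c i k * M (A i) ω‖ ^ 2 ≤ y ∧ t k < ‖∑ i, c i k * M (A i) ω‖} ≤
      ENNReal.ofReal (4 * Real.exp (-(t k ^ 2 / (8 * y)))) := by
    intro k
    have h1 := pi_measure_sum_gt_le (fun i => P.map (M (A i)))
      (fun i => hM.map_neg (hA i) (hAv i)) (fun i => c i k) hy (ht k)
    rw [← hlaw, Measure.map_apply (measurable_pi_lambda _ hMm)] at h1
    · exact h1
    · rw [Set.ofPred_and]
      exact (measurableSet_le (by fun_prop) measurable_const).inter
        (measurableSet_lt measurable_const (by fun_prop))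
  -- A single exceptional event serves every `k`, because `‖c i k‖ ≤ ‖c i‖`; only the Gaussian tails
  -- are summed over `k`.
  refine (measure_mono_ae (t := {ω | y < ∑ i, (‖c i‖ * ‖M (A i) ω‖) ^ (2 : ℝ)} ∪ ⋃ k,
      {ω | ∑ i, ‖c i k * M (A i) ω‖ ^ 2 ≤ y ∧ t k < ‖∑ i, c i k * M (A i) ω‖}) ?_).trans
    ((measure_union_le _ _).trans (add_le_add (h.trans (by gcongr))
      ((measure_iUnion_fintype_le P _).trans (Finset.sum_le_sum fun k _ => hk k))))
  · filter_upwards [ae_all_iff.2 hI] with ω hω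
    rintro ⟨k, hk⟩
    by_cases hyω : y < ∑ i, (‖c i‖ * ‖M (A i) ω‖) ^ (2 : ℝ)
    · exact Or.inl hyω
    · refine Or.inr (Set.mem_iUnion.2 ⟨k, le_trans ?_ (not_lt.1 hyω), by rwa [← hω k]⟩)
      refine Finset.sum_le_sum fun i _ => ?_
      rw [Real.rpow_two, norm_mul]
      gcongr
      exact norm_le_pi_norm (c i) k

/-- Simple approximants need not respect the envelope `b`. The excess is charged to the
approximation errors, with a factor `2 ^ α` that is valid also for `α < 1`, where the triangle
inequality for the norm fails in `L^α`. -/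
lemma enorm_pi_rpow_le {ι : Type*} [Fintype ι] (hα : 0 < α) (u f : ι → ℂ) {b : ℝ}
    (hf : ∀ k, ‖f k‖ ≤ b) (hb : 0 ≤ b) :
    ‖u‖ₑ ^ α ≤ 2 ^ α * (ENNReal.ofReal b ^ α + ∑ k, ‖u k - f k‖ₑ ^ α) := by
  have h1 : ‖u‖ ≤ b + ‖u - f‖ := by
    have : u = f + (u - f) := by abel
    conv_lhs => rw [this]
    exact (norm_add_le _ _).trans (by gcongr; exact (pi_norm_le_iff_of_nonneg hb).2 hf)
  have h2 : ‖u‖ₑ ≤ ENNReal.ofReal b + ‖u - f‖ₑ := by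
    rw [← ofReal_norm u, ← ofReal_norm (u - f), ← ENNReal.ofReal_add hb (norm_nonneg _)]
    exact ENNReal.ofReal_le_ofReal h1
  have h3 : ‖u - f‖ₑ ^ α ≤ ∑ k, ‖u k - f k‖ₑ ^ α := by
    rcases isEmpty_or_nonempty ι with hι | hι
    · have : u - f = 0 := Subsingleton.elim _ _
      simp [this, hα]
    · obtain ⟨k, -, hk⟩ := Finset.exists_mem_eq_sup Finset.univ Finset.univ_nonempty
        fun k => ‖(u - f) k‖₊
      have : ‖u - f‖ₑ = ‖u k - f k‖ₑ := by
        rw [enorm_eq_nnnorm, Pi.nnnorm_def, hk]; rfl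
      rw [this]
      exact Finset.single_le_sum (f := fun k => ‖u k - f k‖ₑ ^ α) (fun _ _ => zero_le)
        (Finset.mem_univ k)
  calc ‖u‖ₑ ^ α ≤ (2 * max (ENNReal.ofReal b) ‖u - f‖ₑ) ^ α := by
        gcongr
        refine h2.trans ?_
        rw [two_mul]
        exact add_le_add (le_max_left _ _) (le_max_right _ _)
    _ = 2 ^ α * max (ENNReal.ofReal b) ‖u - f‖ₑ ^ α := ENNReal.mul_rpow_of_nonneg _ _ hα.le
    _ ≤ 2 ^ α * (ENNReal.ofReal b ^ α + ∑ k, ‖u k - f k‖ₑ ^ α) := by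
        gcongr
        rcases max_cases (ENNReal.ofReal b) ‖u - f‖ₑ with ⟨h, -⟩ | ⟨h, -⟩ <;> rw [h]
        · exact le_self_add
        · exact h3.trans le_add_self

/-- A maximal inequality for integrals of simple functions passes to stable integrals. -/
lemma measure_exists_stableIntegral_gt_le (hα : 0 < α) {ι : Type*} [Fintype ι]
    {f : ι → (Fin N → ℝ) → ℂ} {I : ι → Ω → ℂ} (hI : ∀ k, IsStableIntegral α P M (f k) (I k))
    {h : (Fin N → ℝ) → ℝ} (hh0 : ∀ x, 0 ≤ h x) (hfh : ∀ k x, ‖f k x‖ ≤ h x) {t : ι → ℝ}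
    (ht : ∀ k, 0 < t k) {a b : ℝ≥0∞} (ha : a ≠ ∞)
    (hsimple : ∀ g : ι → SimpleFunc (Fin N → ℝ) ℂ, (∀ k, (g k).FinMeasSupp volume) →
      P {ω | ∃ k, t k < ‖simpleIntegral M (g k) ω‖} ≤
        a * (∫⁻ x, ‖(fun k => g k x : ι → ℂ)‖ₑ ^ α) + b) :
    P {ω | ∃ k, 2 * t k < ‖I k ω‖} ≤ a * (2 ^ α * ∫⁻ x, ENNReal.ofReal (h x) ^ α) + b := by
  choose g hg hgf hgI using fun k => (hI k).exists_approx
  have hα' : ENNReal.ofReal α ≠ 0 := by simpa using hα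
  have hmeas : ∀ n k, AEMeasurable (fun x => ‖g k n x - f k x‖ₑ ^ α) := fun n k =>
    (((g k n).measurable.aemeasurable.sub
      (hI k).memLp.aestronglyMeasurable.aemeasurable).enorm).pow_const _
  have hlim : ∀ k, Tendsto (fun n => ∫⁻ x, ‖g k n x - f k x‖ₑ ^ α) atTop (𝓝 0) := by
    intro k
    have h1 := (hgf k).ennrpow_const α
    rw [ENNReal.zero_rpow_of_pos hα] at h1
    refine h1.congr fun n => ?_
    rw [eLpNorm_eq_lintegral_rpow_enorm_toReal hα' ENNReal.ofReal_ne_top,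
      ENNReal.toReal_ofReal hα.le, ← ENNReal.rpow_mul, one_div_mul_cancel hα.ne', ENNReal.rpow_one]
  -- Half of the level `2 * t k` goes to the simple integral, half to the error in probability.
  have hbound : ∀ n, P {ω | ∃ k, 2 * t k < ‖I k ω‖} ≤
      (a * (2 ^ α * ((∫⁻ x, ENNReal.ofReal (h x) ^ α) +
        ∑ k, ∫⁻ x, ‖g k n x - f k x‖ₑ ^ α)) + b) +
      ∑ k, P {ω | ENNReal.ofReal (t k) ≤ edist (simpleIntegral M (g k n) ω) (I k ω)} := by
    intro n
    have hsub : {ω | ∃ k, 2 * t k < ‖I k ω‖} ⊆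
        {ω | ∃ k, t k < ‖simpleIntegral M (g k n) ω‖} ∪
          ⋃ k, {ω | ENNReal.ofReal (t k) ≤ edist (simpleIntegral M (g k n) ω) (I k ω)} := by
      rintro ω ⟨k, hk⟩
      by_cases hc : t k < ‖simpleIntegral M (g k n) ω‖
      · exact Or.inl ⟨k, hc⟩
      · refine Or.inr (Set.mem_iUnion.2 ⟨k, ?_⟩)
        change ENNReal.ofReal (t k) ≤ edist (simpleIntegral M (g k n) ω) (I k ω)
        rw [edist_dist, dist_comm, dist_eq_norm]
        apply ENNReal.ofReal_le_ofReal
        have := norm_sub_norm_le (I k ω) (simpleIntegral M (g k n) ω)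
        linarith [not_lt.1 hc]
    refine (measure_mono hsub).trans ((measure_union_le _ _).trans (add_le_add ?_
      (measure_iUnion_fintype_le P _)))
    refine (hsimple (fun k => g k n) fun k => hg k n).trans ?_
    gcongr
    calc ∫⁻ x, ‖(fun k => g k n x : ι → ℂ)‖ₑ ^ α
        ≤ ∫⁻ x, 2 ^ α * (ENNReal.ofReal (h x) ^ α + ∑ k, ‖g k n x - f k x‖ₑ ^ α) :=
          lintegral_mono fun x => enorm_pi_rpow_le hα _ (fun k => f k x) (fun k => hfh k x) (hh0 x)
      _ = _ := by
          rw [lintegral_const_mul' _ _ (by simp),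
            lintegral_add_right' _ (Finset.aemeasurable_fun_sum _ fun k _ => hmeas n k),
            lintegral_finsetSum' _ fun k _ => hmeas n k]
  have hs1 : Tendsto (fun n => ∑ k, ∫⁻ x, ‖g k n x - f k x‖ₑ ^ α) atTop (𝓝 0) := by
    simpa using tendsto_finsetSum Finset.univ fun k _ => hlim k
  have hs2 : Tendsto (fun n => ∑ k, P {ω | ENNReal.ofReal (t k) ≤
      edist (simpleIntegral M (g k n) ω) (I k ω)}) atTop (𝓝 0) := by
    simpa using tendsto_finsetSum Finset.univ fun k _ =>
      hgI k (ENNReal.ofReal (t k)) (by simpa using ht k)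
  have h2α : (2 : ℝ≥0∞) ^ α ≠ ∞ := by simp
  have h3 := (((ENNReal.Tendsto.const_mul (ENNReal.Tendsto.const_mul
    (hs1.const_add (∫⁻ x, ENNReal.ofReal (h x) ^ α)) (Or.inr h2α)) (Or.inr ha)).add_const b)).add
      hs2
  simp only [add_zero] at h3
  exact ge_of_tendsto' h3 hbound

end RandomMeasure

/-! ### Maximal inequalities for countable families -/

section Countable

variable {N : ℕ} {Ω : Type*} [MeasurableSpace Ω] {α : ℝ} {P : Measure Ω}
  {M : Set (Fin N → ℝ) → Ω → ℂ}

/-- Continuity from below along the directed finite subfamilies. -/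
lemma measure_exists_le_of_finset {κ : Type*} [Countable κ] {p : κ → Ω → Prop} {b : ℝ≥0∞}
    (h : ∀ F : Finset κ, P {ω | ∃ k : F, p k ω} ≤ b) : P {ω | ∃ k, p k ω} ≤ b := by
  have hU : {ω | ∃ k, p k ω} = ⋃ F : Finset κ, {ω | ∃ k : F, p k ω} := by
    ext ω
    simp only [Set.mem_ofPred_eq, Set.mem_iUnion]
    constructor
    · rintro ⟨k, hk⟩
      exact ⟨{k}, ⟨k, by simp⟩, hk⟩
    · rintro ⟨F, k, hk⟩
      exact ⟨k, hk⟩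
  have hmono : Monotone fun F : Finset κ => {ω | ∃ k : F, p k ω} := by
    rintro F G hFG ω ⟨k, hk⟩
    exact ⟨⟨k, hFG k.2⟩, hk⟩
  rw [hU, hmono.directed_le.measure_iUnion]
  exact iSup_le h

/-- Maximal inequality for a countable family of stable integrals of index less than one. -/
lemma IsStableRandomMeasure.measure_exists_stableIntegral_gt_le_of_lt_one
    [IsProbabilityMeasure P] (hM : IsStableRandomMeasure α P M) (hα : 0 < α) (hα1 : α < 1)
    {κ : Type*} [Countable κ] {f : κ → (Fin N → ℝ) → ℂ} {I : κ → Ω → ℂ}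
    (hI : ∀ k, IsStableIntegral α P M (f k) (I k))
    {h : (Fin N → ℝ) → ℝ} (hh0 : ∀ x, 0 ≤ h x) (hfh : ∀ k x, ‖f k x‖ ≤ h x) {t : ℝ} (ht : 0 < t) :
    P {ω | ∃ k, 2 * t < ‖I k ω‖} ≤ ENNReal.ofReal (tailConst α 1 * t ^ (-α)) *
      (2 ^ α * ∫⁻ x, ENNReal.ofReal (h x) ^ α) := by
  refine measure_exists_le_of_finset fun F => ?_
  have h1 := measure_exists_stableIntegral_gt_le (b := 0) hα (fun k : F => hI k) hh0
    (fun k x => hfh k x) (t := fun _ => t) (fun _ => ht)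
    (ENNReal.ofReal_ne_top (r := tailConst α 1 * t ^ (-α))) fun g hg => by
      rw [add_zero]
      exact hM.measure_exists_simpleIntegral_gt_le_of_lt_one hα hα1 g hg ht
  rwa [add_zero] at h1

/-- Maximal inequality for a countable family of stable integrals. -/
lemma IsStableRandomMeasure.measure_exists_stableIntegral_gt_le
    [IsProbabilityMeasure P] (hM : IsStableRandomMeasure α P M) (hα : 0 < α) (hα2 : α < 2)
    {κ : Type*} [Countable κ] {f : κ → (Fin N → ℝ) → ℂ} {I : κ → Ω → ℂ}
    (hI : ∀ k, IsStableIntegral α P M (f k) (I k))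
    {h : (Fin N → ℝ) → ℝ} (hh0 : ∀ x, 0 ≤ h x) (hfh : ∀ k x, ‖f k x‖ ≤ h x)
    {y : ℝ} (hy : 0 < y) {t : κ → ℝ} (ht : ∀ k, 0 < t k) :
    P {ω | ∃ k, 2 * t k < ‖I k ω‖} ≤ ENNReal.ofReal (tailConst α 2 * y ^ (-(α / 2))) *
      (2 ^ α * ∫⁻ x, ENNReal.ofReal (h x) ^ α) +
      ∑' k, ENNReal.ofReal (4 * Real.exp (-(t k ^ 2 / (8 * y)))) := by
  refine measure_exists_le_of_finset (p := fun k ω => 2 * t k < ‖I k ω‖) fun F => ?_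
  refine HFSS.measure_exists_stableIntegral_gt_le hα (fun k : F => hI k) hh0
    (fun k x => hfh k x) (t := fun k => t k) (fun k => ht k) ENNReal.ofReal_ne_top fun g hg => ?_
  refine (hM.measure_exists_simpleIntegral_gt_le hα hα2 g hg hy fun k => (ht k).le).trans ?_
  gcongr
  rw [Finset.sum_coe_sort F fun k => ENNReal.ofReal (4 * Real.exp (-(t k ^ 2 / (8 * y))))]
  exact ENNReal.sum_le_tsum F

end Countable

/-! ### The renormalized wavelets in the frequency domain -/

lemma fourierU_psi (ψ : 𝓢(ℝ, ℝ)) (j k : ℤ) (ξ : ℝ) :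
    fourierU (psi ψ j k) ξ =
      (((2 : ℝ) ^ ((j : ℝ) / 2) * ((2 : ℝ) ^ j)⁻¹ : ℝ) : ℂ) *
        Complex.exp (((-(k * (ξ / 2 ^ j)) : ℝ) : ℂ) * Complex.I) *
        fourierU (fun x => (ψ x : ℂ)) (ξ / 2 ^ j) := by
  have h2 : (0 : ℝ) < (2 : ℝ) ^ j := by positivity
  set H : ℝ → ℂ := fun v => Complex.exp (-(Complex.I * v * ((ξ / 2 ^ j : ℝ) : ℂ))) *
    (((2 : ℝ) ^ ((j : ℝ) / 2) * ψ (v - k) : ℝ) : ℂ) with hH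
  have h1 : (∫ s : ℝ, Complex.exp (-(Complex.I * s * ξ)) * psi ψ j k s) =
      (((2 : ℝ) ^ j)⁻¹ : ℝ) • ∫ v : ℝ, H v := by
    have := Measure.integral_comp_mul_left H ((2 : ℝ) ^ j)
    rw [abs_of_pos (inv_pos.2 h2)] at this
    rw [← this]
    congr 1
    ext s
    simp only [hH, psi]
    congr 3
    have : (((2 : ℝ) ^ j : ℝ) : ℂ) ≠ 0 := by exact_mod_cast h2.ne'
    push_cast at this ⊢
    field_simp
  have h3 : ∫ v : ℝ, H v = ∫ v : ℝ, H (v + k) := (integral_add_right_eq_self H (k : ℝ)).symm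
  have h4 : ∀ v : ℝ, H (v + k) = ((((2 : ℝ) ^ ((j : ℝ) / 2) : ℝ) : ℂ) *
      Complex.exp (((-(k * (ξ / 2 ^ j)) : ℝ) : ℂ) * Complex.I)) *
        (Complex.exp (-(Complex.I * v * ((ξ / 2 ^ j : ℝ) : ℂ))) * (ψ v : ℂ)) := by
    intro v
    have hexp : Complex.exp (-(Complex.I * ((v + k : ℝ) : ℂ) * ((ξ / 2 ^ j : ℝ) : ℂ))) =
        Complex.exp (((-(k * (ξ / 2 ^ j)) : ℝ) : ℂ) * Complex.I) *
          Complex.exp (-(Complex.I * v * ((ξ / 2 ^ j : ℝ) : ℂ))) := by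
      rw [← Complex.exp_add]
      congr 1
      push_cast
      ring
    simp only [hH]
    rw [hexp, add_sub_cancel_right]
    push_cast
    ring
  rw [fourierU, fourierU, h1, h3]
  simp_rw [h4]
  rw [integral_const_mul, Complex.real_smul]
  push_cast
  ring

/-- The phase carrying `k` has modulus one, and the exponents `-j(1/α - 1/2)`, `j/2` and `-j` add up
to `-j/α`. -/
lemma norm_hatPsi {α : ℝ} (ψ : 𝓢(ℝ, ℝ)) (j k : ℤ) (ξ : ℝ) :
    ‖hatPsi α ψ j k ξ‖ = (2 : ℝ) ^ (-(j : ℝ) / α) * ‖fourierU (fun x => (ψ x : ℂ)) (ξ / 2 ^ j)‖ := by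
  rw [hatPsi, fourierU_psi, norm_mul, norm_mul, norm_mul, Complex.norm_exp_ofReal_mul_I,
    Complex.norm_real, Complex.norm_real, Real.norm_of_nonneg (by positivity),
    Real.norm_of_nonneg (by positivity), mul_one, ← mul_assoc]
  congr 1
  rw [← Real.rpow_intCast, ← Real.rpow_neg (by norm_num), ← Real.rpow_add (by norm_num),
    ← Real.rpow_add (by norm_num)]
  congr 1
  ring

lemma norm_hatPsiTensor {N : ℕ} {α : ℝ} (ψ : 𝓢(ℝ, ℝ)) (J K : Fin N → ℤ) (x : Fin N → ℝ) :
    ‖hatPsiTensor α ψ J K x‖ =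
      ∏ l, (2 : ℝ) ^ (-(J l : ℝ) / α) * ‖fourierU (fun x => (ψ x : ℂ)) (x l / 2 ^ J l)‖ := by
  simp_rw [hatPsiTensor, norm_prod, norm_hatPsi]

/-- The factor `2 ^ (-j/α)`, raised to the power `α`, is exactly the Jacobian of the dilation by `2
^ (-j)` in each coordinate. -/
lemma lintegral_norm_hatPsiTensor {N : ℕ} {α : ℝ} (hα : 0 < α) (ψ : 𝓢(ℝ, ℝ)) (J K : Fin N → ℤ) :
    ∫⁻ x, ENNReal.ofReal ‖hatPsiTensor α ψ J K x‖ ^ α =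
      ∫⁻ x, ENNReal.ofReal ‖hatPsiTensor α ψ (0 : Fin N → ℤ) (0 : Fin N → ℤ) x‖ ^ α := by
  set F : (Fin N → ℝ) → ℝ≥0∞ := fun x =>
    ENNReal.ofReal ‖hatPsiTensor α ψ (0 : Fin N → ℤ) (0 : Fin N → ℤ) x‖ ^ α with hF
  set D : Fin N → ℝ := fun l => ((2 : ℝ) ^ J l)⁻¹ with hD
  have hDpos : ∀ l, 0 < D l := fun l => by positivity
  have hdet : (Matrix.diagonal D).det = ∏ l, D l := Matrix.det_diagonal
  have hpos : 0 < ∏ l, D l := Finset.prod_pos fun l _ => hDpos l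
  have hpt : ∀ x, ENNReal.ofReal ‖hatPsiTensor α ψ J K x‖ ^ α =
      ENNReal.ofReal (∏ l, D l) * F (Matrix.toLin' (Matrix.diagonal D) x) := by
    intro x
    simp only [hF]
    rw [ENNReal.ofReal_rpow_of_nonneg (norm_nonneg _) hα.le,
      ENNReal.ofReal_rpow_of_nonneg (norm_nonneg _) hα.le, ← ENNReal.ofReal_mul hpos.le,
      norm_hatPsiTensor, norm_hatPsiTensor, ← Real.finsetProd_rpow _ _ fun l _ => by positivity,
      ← Real.finsetProd_rpow _ _ fun l _ => by positivity, ← Finset.prod_mul_distrib]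
    congr 1
    refine Finset.prod_congr rfl fun l _ => ?_
    rw [Matrix.toLin'_apply, Matrix.mulVec_diagonal, Real.mul_rpow (by positivity) (by positivity),
      Real.mul_rpow (by positivity) (by positivity), ← Real.rpow_mul (by norm_num),
      div_mul_cancel₀ _ hα.ne', Real.rpow_neg (by norm_num), Real.rpow_intCast]
    simp [hD, div_eq_inv_mul]
  simp_rw [hpt]
  rw [lintegral_const_mul' _ _ ENNReal.ofReal_ne_top]
  -- Being an embedding, the dilation allows the change of variables without measurability of `F`.
  have hemb : MeasurableEmbedding (Matrix.toLin' (Matrix.diagonal D)) := by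
    have : (Matrix.toLin' (Matrix.diagonal D) : (Fin N → ℝ) → Fin N → ℝ) =
        Homeomorph.piCongrRight fun l => Homeomorph.mulLeft₀ (D l) (hDpos l).ne' := by
      ext x l
      simp [Matrix.toLin'_apply, Matrix.mulVec_diagonal]
    rw [this]
    exact Homeomorph.measurableEmbedding _
  have hvol := Real.smul_map_diagonal_volume_pi (D := D) (by rw [hdet]; exact hpos.ne')
  conv_rhs => rw [← hvol]
  rw [lintegral_smul_measure, hemb.lintegral_map, hdet, abs_of_pos hpos, smul_eq_mul]

lemma lintegral_norm_hatPsiTensor_ne_top {N : ℕ} {α : ℝ} (hα : 0 < α) (ψ : 𝓢(ℝ, ℝ))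
    (J K : Fin N → ℤ)
    (h : MemLp (fun x => conj (hatPsiTensor α ψ J K x)) (ENNReal.ofReal α) volume) :
    ∫⁻ x, ENNReal.ofReal ‖hatPsiTensor α ψ J K x‖ ^ α ≠ ∞ := by
  have h1 := (eLpNorm_lt_top_iff_lintegral_rpow_enorm_lt_top (by simpa using hα)
    ENNReal.ofReal_ne_top).1 h.2
  rw [ENNReal.toReal_ofReal hα.le] at h1
  refine (lt_of_eq_of_lt (lintegral_congr fun x => ?_) h1).ne
  rw [← ofReal_norm, RCLike.norm_conj]

/-! ### Sums over integer vectors -/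

lemma tsum_pi_prod (p : ℤ → ℝ≥0∞) (N : ℕ) :
    ∑' n : Fin N → ℤ, ∏ l, p (n l) = (∑' k, p k) ^ N := by
  induction N with
  | zero => simp
  | succ N ih =>
    rw [← (Fin.consEquiv fun _ : Fin (N + 1) => ℤ).tsum_eq, ENNReal.tsum_prod', pow_succ',
      ← ENNReal.tsum_mul_right]
    refine tsum_congr fun k => ?_
    rw [← ih, ← ENNReal.tsum_mul_left]
    refine tsum_congr fun n => ?_
    simp [Fin.consEquiv, Fin.prod_univ_succ]

lemma tsum_one_add_abs_rpow_ne_top {s : ℝ} (hs : 1 < s) :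
    ∑' k : ℤ, ENNReal.ofReal ((1 + |(k : ℝ)|) ^ (-s)) ≠ ∞ := by
  refine Summable.tsum_ofReal_ne_top ?_
  refine Summable.of_norm_bounded_eventually (Real.summable_abs_int_rpow hs) ?_
  filter_upwards [(Set.finite_singleton (0 : ℤ)).compl_mem_cofinite] with k hk
  have hk0 : 0 < |(k : ℝ)| := by
    rw [abs_pos]; exact_mod_cast hk
  rw [Real.norm_of_nonneg (by positivity)]
  exact Real.rpow_le_rpow_of_nonpos hk0 (by linarith) (by linarith)

lemma log_two_le_log_two_add_abs (k : ℤ) : Real.log 2 ≤ Real.log (2 + |(k : ℝ)|) :=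
  Real.log_le_log (by norm_num) (by linarith [abs_nonneg (k : ℝ)])

lemma log_two_add_abs_pos (k : ℤ) : 0 < Real.log (2 + |(k : ℝ)|) :=
  (Real.log_pos (by norm_num)).trans_le (log_two_le_log_two_add_abs k)

/-- A product of logarithms dominates the corresponding sum. -/
lemma one_add_sum_log_le {N : ℕ} (n : Fin N → ℤ) :
    1 + ∑ l, Real.log (2 + |(n l : ℝ)|) / Real.log 2 ≤
      (N + 1) * ∏ l, (Real.log (2 + |(n l : ℝ)|) / Real.log 2) := by
  have hlog : 0 < Real.log 2 := Real.log_pos (by norm_num)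
  set a : Fin N → ℝ := fun l => Real.log (2 + |(n l : ℝ)|) / Real.log 2 with ha
  have ha1 : ∀ l, 1 ≤ a l := fun l => (one_le_div hlog).2 (log_two_le_log_two_add_abs _)
  have h1 : 1 ≤ ∏ l, a l := Finset.one_le_prod fun l _ => ha1 l
  have h2 : ∀ l, a l ≤ ∏ l, a l := fun l => by
    rw [← Finset.mul_prod_erase _ a (Finset.mem_univ l)]
    exact le_mul_of_one_le_right (by linarith [ha1 l]) (Finset.one_le_prod fun l _ => ha1 l)
  have h3 : ∑ l, a l ≤ N * ∏ l, a l := by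
    refine (Finset.sum_le_sum fun l _ => h2 l).trans_eq ?_
    simp
  linarith

/-- The rate of decay in `exp_neg_mul_prod_log_le`. -/
noncomputable def decayRate (N : ℕ) : ℝ := Real.log 2 ^ N * Real.log 2 ^ N / (16 * (N + 1))

lemma decayRate_pos (N : ℕ) : 0 < decayRate N := by
  have hlog : 0 < Real.log 2 := Real.log_pos (by norm_num)
  unfold decayRate
  positivity

lemma exp_neg_mul_sum_log_le {N : ℕ} (n : Fin N → ℤ) {s : ℝ} (hs : 2 * Real.log 2 ≤ s) :
    Real.exp (-(s * ∑ l, Real.log (2 + |(n l : ℝ)|) / Real.log 2)) ≤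
      ∏ l, (1 + |(n l : ℝ)|) ^ (-2 : ℝ) := by
  have hlog : 0 < Real.log 2 := Real.log_pos (by norm_num)
  rw [Finset.mul_sum, ← Finset.sum_neg_distrib, Real.exp_sum]
  refine Finset.prod_le_prod (fun l _ => by positivity) fun l _ => ?_
  have hpos : 0 < 2 + |(n l : ℝ)| := by positivity
  calc Real.exp (-(s * (Real.log (2 + |(n l : ℝ)|) / Real.log 2)))
      ≤ Real.exp (Real.log (2 + |(n l : ℝ)|) * (-2)) := by
        gcongr
        have h := log_two_add_abs_pos (n l)
        have : 2 * Real.log (2 + |(n l : ℝ)|) ≤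
            s * (Real.log (2 + |(n l : ℝ)|) / Real.log 2) := by
          rw [← mul_div_assoc, le_div_iff₀ hlog]
          nlinarith
        linarith
    _ = (2 + |(n l : ℝ)|) ^ (-2 : ℝ) := (Real.rpow_def_of_pos hpos _).symm
    _ ≤ _ := Real.rpow_le_rpow_of_nonpos (by positivity) (by linarith) (by norm_num)

/-- The product of logarithms dominates a multiple of `1` plus the sums of logarithms over `J` and
`K`. The `1` yields decay in `x`, the sums yield summable weights. In `decayRate`, 16(N+1) is
Hoeffding's 8 times the 2(N+1) of `huv`. -/
lemma exp_neg_mul_prod_log_le {N : ℕ} (J K : Fin N → ℤ) {x : ℝ} (hx : 0 ≤ x)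
    (hxc : 2 * Real.log 2 ≤ x * decayRate N) :
    Real.exp (-(x * ((∏ l, Real.log (2 + |(J l : ℝ)|)) * ∏ l, Real.log (2 + |(K l : ℝ)|)) / 8)) ≤
      Real.exp (-(x * decayRate N)) *
        ((∏ l, (1 + |(J l : ℝ)|) ^ (-2 : ℝ)) * ∏ l, (1 + |(K l : ℝ)|) ^ (-2 : ℝ)) := by
  have hlog : 0 < Real.log 2 := Real.log_pos (by norm_num)
  have hprod : ∀ n : Fin N → ℤ, ∏ l, Real.log (2 + |(n l : ℝ)|) =
      Real.log 2 ^ N * ∏ l, (Real.log (2 + |(n l : ℝ)|) / Real.log 2) := by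
    intro n
    rw [Finset.prod_div_distrib, Finset.prod_const, Finset.card_univ, Fintype.card_fin]
    field_simp
  have hone : ∀ n : Fin N → ℤ, 1 ≤ ∏ l, (Real.log (2 + |(n l : ℝ)|) / Real.log 2) := fun n =>
    Finset.one_le_prod fun l _ => (one_le_div hlog).2 (log_two_le_log_two_add_abs _)
  have hJ := one_add_sum_log_le J
  have hK := one_add_sum_log_le K
  have hJ1 := hone J
  have hK1 := hone K
  rw [hprod J, hprod K]
  refine le_trans ?_ (mul_le_mul_of_nonneg_left (mul_le_mul (exp_neg_mul_sum_log_le J hxc)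
    (exp_neg_mul_sum_log_le K hxc) (by positivity) (by positivity)) (by positivity))
  rw [← Real.exp_add, ← Real.exp_add]
  apply Real.exp_le_exp.2
  set p := ∏ l, (Real.log (2 + |(J l : ℝ)|) / Real.log 2)
  set q := ∏ l, (Real.log (2 + |(K l : ℝ)|) / Real.log 2)
  set u := ∑ l, Real.log (2 + |(J l : ℝ)|) / Real.log 2
  set v := ∑ l, Real.log (2 + |(K l : ℝ)|) / Real.log 2
  have hN : (0 : ℝ) < N + 1 := by positivity
  have hpq : (p + q) / 2 ≤ p * q := by nlinarith
  have huv : 1 + u + v ≤ 2 * (N + 1) * (p * q) := by nlinarith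
  have hc : x * (Real.log 2 ^ N * p * (Real.log 2 ^ N * q)) / 8 =
      x * decayRate N * (2 * (N + 1) * (p * q)) := by
    unfold decayRate
    field_simp
    ring
  have := mul_le_mul_of_nonneg_left huv (mul_nonneg hx (decayRate_pos N).le)
  rw [hc]
  linarith

/-! ### Measurable random constants -/

/-- Countably many variables that are almost surely `O(W η)` for each `η > 0` are so on one event
of probability one, with measurable constants. -/
lemma exists_measurable_bound {Ω : Type*} [MeasurableSpace Ω] {P : Measure Ω}
    [IsProbabilityMeasure P] {ι : Type*} [Countable ι] {X : ι → Ω → ℂ} (hX : ∀ i, Measurable (X i))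
    {W : ℝ → ι → ℝ} (hW : ∀ η i, 0 < W η i) (hmono : ∀ i, Monotone fun η => W η i)
    (hae : ∀ η, 0 < η → ∀ᵐ ω ∂P, ∃ T : ℝ, ∀ i, ‖X i ω‖ ≤ T * W η i) :
    ∃ Ωstar : Set Ω, MeasurableSet Ωstar ∧ P Ωstar = 1 ∧
      ∀ η : ℝ, 0 < η → ∃ C : Ω → ℝ, Measurable C ∧ (∀ ω, 0 < C ω) ∧
        ∀ ω ∈ Ωstar, ∀ i, ‖X i ω‖ ≤ C ω * W η i := by
  -- Countably many exponents `1/(n+1)` suffice, as `W` is monotone in `η`; hence one event for all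
  -- `η`.
  have hall : ∀ᵐ ω ∂P, ∀ n : ℕ, ∃ T : ℝ, ∀ i, ‖X i ω‖ ≤ T * W (1 / (n + 1)) i :=
    ae_all_iff.2 fun n => hae _ (by positivity)
  obtain ⟨s, hs, hsm, hsX⟩ := hall.exists_measurable_mem
  refine ⟨s, hsm, mem_ae_iff_prob_eq_one hsm |>.1 hs, fun η hη => ?_⟩
  -- The supremum is taken in `ℝ≥0∞` for measurability. Where it is infinite `toReal` gives 0, so
  -- the constant stays positive everywhere.
  refine ⟨fun ω => 1 + (⨆ i, ENNReal.ofReal (‖X i ω‖ / W η i)).toReal, ?_, fun ω => by positivity,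
    fun ω hω i => ?_⟩
  · exact measurable_const.add
      (Measurable.iSup fun i => ((hX i).norm.div_const _).ennreal_ofReal).ennreal_toReal
  · obtain ⟨n, hn⟩ := exists_nat_one_div_lt hη
    obtain ⟨T, hT⟩ := hsX ω hω n
    have hfin : ⨆ i, ENNReal.ofReal (‖X i ω‖ / W η i) ≤ ENNReal.ofReal |T| := by
      refine iSup_le fun i => ENNReal.ofReal_le_ofReal ?_
      rw [div_le_iff₀ (hW η i)]
      calc ‖X i ω‖ ≤ T * W (1 / (n + 1)) i := hT i
        _ ≤ |T| * W (1 / (n + 1)) i :=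
          mul_le_mul_of_nonneg_right (le_abs_self T) (hW _ i).le
        _ ≤ |T| * W η i := mul_le_mul_of_nonneg_left (hmono i hn.le) (abs_nonneg T)
    have h1 : ‖X i ω‖ / W η i ≤ (⨆ i, ENNReal.ofReal (‖X i ω‖ / W η i)).toReal :=
      (ENNReal.ofReal_le_iff_le_toReal (ne_top_of_le_ne_top ENNReal.ofReal_ne_top hfin)).1
        (le_iSup (fun i => ENNReal.ofReal (‖X i ω‖ / W η i)) i)
    exact (div_le_iff₀ (hW η i)).1 (h1.trans (by linarith))

/-- If no `T` works then `T = 2x` fails for every `x`, so the exceptional set has measure at most `b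
x` for all large `x`. -/
lemma ae_exists_bound_of_tendsto {Ω : Type*} [MeasurableSpace Ω] {P : Measure Ω} {ι : Type*}
    {X : ι → Ω → ℂ} {W : ι → ℝ} {b : ℝ → ℝ≥0∞} (hb : Tendsto b atTop (𝓝 0))
    (h : ∀ᶠ x in atTop, P {ω | ∃ i, 2 * (x * W i) < ‖X i ω‖} ≤ b x) :
    ∀ᵐ ω ∂P, ∃ T : ℝ, ∀ i, ‖X i ω‖ ≤ T * W i := by
  rw [ae_iff]
  refine le_antisymm (ge_of_tendsto hb (h.mono fun x hx => le_trans (measure_mono ?_) hx)) zero_le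
  intro ω hω
  have h1 : ¬ ∃ T : ℝ, ∀ i, ‖X i ω‖ ≤ T * W i := hω
  push Not at h1
  obtain ⟨i, hi⟩ := h1 (2 * x)
  exact ⟨i, by rwa [← mul_assoc]⟩

/-! ### The wavelet coefficients -/

section Coefficients

variable {N : ℕ} {Ω : Type*} [MeasurableSpace Ω] {α : ℝ} {P : Measure Ω}
  {M : Set (Fin N → ℝ) → Ω → ℂ} {ψ : 𝓢(ℝ, ℝ)} {ε : (Fin N → ℤ) → (Fin N → ℤ) → Ω → ℂ}

lemma norm_conj_hatPsiTensor_le (J K : Fin N → ℤ) (x : Fin N → ℝ) :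
    ‖conj (hatPsiTensor α ψ J K x)‖ ≤ ‖hatPsiTensor α ψ J (0 : Fin N → ℤ) x‖ := by
  rw [RCLike.norm_conj, norm_hatPsiTensor, norm_hatPsiTensor]

/-- Only `J` is subjected to a union bound; `K` is left to the maximal inequality. -/
lemma measure_exists_pair_le_tsum (p : (Fin N → ℤ) → (Fin N → ℤ) → Ω → Prop) :
    P {ω | ∃ i : (Fin N → ℤ) × (Fin N → ℤ), p i.1 i.2 ω} ≤ ∑' J, P {ω | ∃ K, p J K ω} := by
  refine le_trans (measure_mono ?_) (measure_iUnion_le _)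
  rintro ω ⟨⟨J, K⟩, h⟩
  exact Set.mem_iUnion.2 ⟨J, K, h⟩

/-- The weight `∏ (1 + |j_l|) ^ s` raised to a power. -/
lemma ofReal_mul_prod_rpow {C x s b : ℝ} (hC : 0 ≤ C) (hx : 0 ≤ x) (J : Fin N → ℤ) :
    ENNReal.ofReal (C * (x * ∏ l, (1 + |(J l : ℝ)|) ^ s) ^ b) =
      ENNReal.ofReal (C * x ^ b) * ∏ l, ENNReal.ofReal ((1 + |(J l : ℝ)|) ^ (s * b)) := by
  rw [Real.mul_rpow hx (by positivity), ← mul_assoc, ENNReal.ofReal_mul (by positivity),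
    ← Real.finsetProd_rpow _ _ fun l _ => by positivity,
    ENNReal.ofReal_prod_of_nonneg fun l _ => by positivity]
  congr 1
  refine Finset.prod_congr rfl fun l _ => ?_
  rw [← Real.rpow_mul (by positivity)]

lemma tailConst_nonneg {p : ℝ} (hα : 0 < α) (hp : α < p) : 0 ≤ tailConst α p := by
  have : α / p < 1 := (div_lt_one (hα.trans hp)).2 hp
  have : 0 < 1 - α / p := by linarith
  unfold tailConst
  positivity

lemma tendsto_ofReal_mul_rpow_neg {C b : ℝ} (hb : 0 < b) :
    Tendsto (fun x : ℝ => ENNReal.ofReal (C * x ^ (-b))) atTop (𝓝 0) := by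
  have h := (tendsto_rpow_neg_atTop hb).const_mul C
  rw [mul_zero] at h
  simpa using ENNReal.tendsto_ofReal h

lemma ae_exists_bound_of_lt_one [IsProbabilityMeasure P] (hα : 0 < α) (hα1 : α < 1)
    (hM : IsStableRandomMeasure α P M)
    (hε : ∀ J K, IsStableIntegral α P M (fun x => conj (hatPsiTensor α ψ J K x)) (ε J K))
    {η : ℝ} (hη : 0 < η) :
    ∀ᵐ ω ∂P, ∃ T : ℝ, ∀ i : (Fin N → ℤ) × (Fin N → ℤ),
      ‖ε i.1 i.2 ω‖ ≤ T * ∏ l, (1 + |(i.1 l : ℝ)|) ^ (1 / α + η) := by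
  set S := ∫⁻ x, ENNReal.ofReal
    ‖hatPsiTensor α ψ (0 : Fin N → ℤ) (0 : Fin N → ℤ) x‖ ^ α with hS
  have hSfin : S ≠ ∞ := lintegral_norm_hatPsiTensor_ne_top hα ψ 0 0 (hε 0 0).memLp
  set Q := ∑' k : ℤ, ENNReal.ofReal ((1 + |(k : ℝ)|) ^ (-(1 + α * η))) with hQ
  have hQfin : Q ≠ ∞ := tsum_one_add_abs_rpow_ne_top (by linarith [mul_pos hα hη])
  have hlim : Tendsto (fun x : ℝ => ENNReal.ofReal (tailConst α 1 * x ^ (-α)) *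
      (Q ^ N * (2 ^ α * S))) atTop (𝓝 0) := by
    have h := ENNReal.Tendsto.mul_const (b := Q ^ N * (2 ^ α * S))
      (tendsto_ofReal_mul_rpow_neg (C := tailConst α 1) hα)
      (Or.inr (by finiteness))
    rwa [zero_mul] at h
  refine ae_exists_bound_of_tendsto hlim ?_
  filter_upwards [eventually_gt_atTop 0] with x hx
  refine (measure_exists_pair_le_tsum fun J K ω =>
    2 * (x * ∏ l, (1 + |(J l : ℝ)|) ^ (1 / α + η)) < ‖ε J K ω‖).trans ?_
  calc _ ≤ ∑' J : Fin N → ℤ, ENNReal.ofReal (tailConst α 1 * x ^ (-α)) *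
        (∏ l, ENNReal.ofReal ((1 + |(J l : ℝ)|) ^ (-(1 + α * η)))) * (2 ^ α * S) := by
        refine ENNReal.tsum_le_tsum fun J => ?_
        refine (hM.measure_exists_stableIntegral_gt_le_of_lt_one hα hα1 (hε J)
          (fun x => norm_nonneg _) (norm_conj_hatPsiTensor_le J)
          (t := x * ∏ l, (1 + |(J l : ℝ)|) ^ (1 / α + η)) (by positivity)).trans_eq ?_
        rw [lintegral_norm_hatPsiTensor hα, ofReal_mul_prod_rpow (tailConst_nonneg hα hα1) hx.le,
          show (1 / α + η) * -α = -(1 + α * η) by field_simp]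
    _ = _ := by
        rw [ENNReal.tsum_mul_right, ENNReal.tsum_mul_left,
          tsum_pi_prod fun k => ENNReal.ofReal ((1 + |(k : ℝ)|) ^ (-(1 + α * η))), mul_assoc]

lemma ae_exists_bound_of_lt_two [IsProbabilityMeasure P] (hα : 0 < α) (hα2 : α < 2)
    (hM : IsStableRandomMeasure α P M)
    (hε : ∀ J K, IsStableIntegral α P M (fun x => conj (hatPsiTensor α ψ J K x)) (ε J K))
    {η : ℝ} (hη : 0 < η) :
    ∀ᵐ ω ∂P, ∃ T : ℝ, ∀ i : (Fin N → ℤ) × (Fin N → ℤ),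
      ‖ε i.1 i.2 ω‖ ≤ T * ∏ l, ((1 + |(i.1 l : ℝ)|) ^ (1 / α + η) *
        √(Real.log (2 + |(i.1 l : ℝ)|)) * √(Real.log (2 + |(i.2 l : ℝ)|))) := by
  set S := ∫⁻ x, ENNReal.ofReal
    ‖hatPsiTensor α ψ (0 : Fin N → ℤ) (0 : Fin N → ℤ) x‖ ^ α with hS
  have hSfin : S ≠ ∞ := lintegral_norm_hatPsiTensor_ne_top hα ψ 0 0 (hε 0 0).memLp
  set Q := ∑' k : ℤ, ENNReal.ofReal ((1 + |(k : ℝ)|) ^ (-(1 + α * η))) with hQ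
  have hQfin : Q ≠ ∞ := tsum_one_add_abs_rpow_ne_top (by linarith [mul_pos hα hη])
  set R := ∑' k : ℤ, ENNReal.ofReal ((1 + |(k : ℝ)|) ^ (-2 : ℝ)) with hR
  have hRfin : R ≠ ∞ := tsum_one_add_abs_rpow_ne_top (by norm_num)
  have hc := decayRate_pos N
  have hlim : Tendsto (fun x : ℝ => ENNReal.ofReal (tailConst α 2 * x ^ (-(α / 2))) *
      (Q ^ N * (2 ^ α * S)) + ENNReal.ofReal (4 * Real.exp (-(x * decayRate N))) * (R ^ N * R ^ N))
      atTop (𝓝 0) := by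
    have h1 := ENNReal.Tendsto.mul_const (b := Q ^ N * (2 ^ α * S))
      (tendsto_ofReal_mul_rpow_neg (C := tailConst α 2) (half_pos hα))
      (Or.inr (by finiteness))
    have h2 : Tendsto (fun x : ℝ => ENNReal.ofReal (4 * Real.exp (-(x * decayRate N)))) atTop
        (𝓝 0) := by
      have h := (Real.tendsto_exp_neg_atTop_nhds_zero.comp
        (tendsto_id.atTop_mul_const hc)).const_mul 4
      rw [mul_zero] at h
      simpa using ENNReal.tendsto_ofReal h
    have h3 := ENNReal.Tendsto.mul_const (b := R ^ N * R ^ N) h2 (Or.inr (by finiteness))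
    simpa using h1.add h3
  refine ae_exists_bound_of_tendsto hlim ?_
  filter_upwards [eventually_gt_atTop 0, eventually_ge_atTop (2 * Real.log 2 / decayRate N)]
    with x hx hxc
  rw [div_le_iff₀ hc] at hxc
  refine (measure_exists_pair_le_tsum fun J K ω =>
    2 * (x * ∏ l, ((1 + |(J l : ℝ)|) ^ (1 / α + η) *
        √(Real.log (2 + |(J l : ℝ)|)) * √(Real.log (2 + |(K l : ℝ)|)))) < ‖ε J K ω‖).trans ?_
  calc _ ≤ ∑' J : Fin N → ℤ, (ENNReal.ofReal (tailConst α 2 * x ^ (-(α / 2))) *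
        (∏ l, ENNReal.ofReal ((1 + |(J l : ℝ)|) ^ (-(1 + α * η)))) * (2 ^ α * S) +
        ∑' K : Fin N → ℤ, ENNReal.ofReal (4 * Real.exp (-(x * decayRate N))) *
          ((∏ l, ENNReal.ofReal ((1 + |(J l : ℝ)|) ^ (-2 : ℝ))) *
            ∏ l, ENNReal.ofReal ((1 + |(K l : ℝ)|) ^ (-2 : ℝ)))) := by
        refine ENNReal.tsum_le_tsum fun J => ?_
        have hpos : ∀ K : Fin N → ℤ, 0 < x * ∏ l, ((1 + |(J l : ℝ)|) ^ (1 / α + η) *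
            √(Real.log (2 + |(J l : ℝ)|)) * √(Real.log (2 + |(K l : ℝ)|))) := fun K => by
          refine mul_pos hx (Finset.prod_pos fun l _ => ?_)
          have h1 := Real.sqrt_pos.2 (log_two_add_abs_pos (J l))
          have h2 := Real.sqrt_pos.2 (log_two_add_abs_pos (K l))
          positivity
        -- This `y` is `x` times the squared power weights: its power `-(α/2)` is summable in `J`,
        -- while `t²/(8y)` retains only `x/8` times the product of logarithms.
        refine (hM.measure_exists_stableIntegral_gt_le hα hα2 (hε J)
          (fun x => norm_nonneg _) (norm_conj_hatPsiTensor_le J)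
          (y := x * ∏ l, (1 + |(J l : ℝ)|) ^ (2 * (1 / α + η))) (by positivity) hpos).trans ?_
        rw [lintegral_norm_hatPsiTensor hα, ofReal_mul_prod_rpow (tailConst_nonneg hα hα2) hx.le,
          show 2 * (1 / α + η) * -(α / 2) = -(1 + α * η) by field_simp]
        gcongr with K
        rw [← ENNReal.ofReal_prod_of_nonneg fun l _ => by positivity,
          ← ENNReal.ofReal_prod_of_nonneg fun l _ => by positivity,
          ← ENNReal.ofReal_mul (by positivity), ← ENNReal.ofReal_mul (by positivity), mul_assoc]
        apply ENNReal.ofReal_le_ofReal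
        refine mul_le_mul_of_nonneg_left (le_trans (le_of_eq ?_)
          (exp_neg_mul_prod_log_le J K hx.le hxc)) (by norm_num)
        congr 2
        have hsq : (∏ l, ((1 + |(J l : ℝ)|) ^ (1 / α + η) *
            √(Real.log (2 + |(J l : ℝ)|)) * √(Real.log (2 + |(K l : ℝ)|)))) ^ 2 =
            (∏ l, (1 + |(J l : ℝ)|) ^ (2 * (1 / α + η))) *
            ((∏ l, Real.log (2 + |(J l : ℝ)|)) * ∏ l, Real.log (2 + |(K l : ℝ)|)) := by
          rw [← Finset.prod_pow, ← Finset.prod_mul_distrib, ← Finset.prod_mul_distrib]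
          refine Finset.prod_congr rfl fun l _ => ?_
          rw [mul_pow, mul_pow, Real.sq_sqrt (log_two_add_abs_pos _).le,
            Real.sq_sqrt (log_two_add_abs_pos _).le, mul_comm 2 (1 / α + η),
            Real.rpow_mul (by positivity), Real.rpow_two, mul_assoc]
        have hw : (0 : ℝ) < ∏ l, (1 + |(J l : ℝ)|) ^ (2 * (1 / α + η)) := by positivity
        rw [mul_pow, hsq]
        field_simp
    _ = _ := by
        rw [ENNReal.tsum_add, ENNReal.tsum_mul_right, ENNReal.tsum_mul_left,
          tsum_pi_prod fun k => ENNReal.ofReal ((1 + |(k : ℝ)|) ^ (-(1 + α * η))), mul_assoc]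
        simp_rw [ENNReal.tsum_mul_left, ENNReal.tsum_mul_right]
        rw [tsum_pi_prod fun k => ENNReal.ofReal ((1 + |(k : ℝ)|) ^ (-2 : ℝ))]

end Coefficients

end HFSS

/-! ### The almost sure bounds -/

theorem mainTheorem4 {N : ℕ} {α : ℝ} (hα0 : 0 < α) (hα2 : α < 2)
    (ψ : 𝓢(ℝ, ℝ)) (hψ : HFSS.IsLemarieMeyer ψ)
    {Ω : Type*} [MeasurableSpace Ω] (P : Measure Ω) [IsProbabilityMeasure P]
    (M : Set (Fin N → ℝ) → Ω → ℂ) (hM : HFSS.IsStableRandomMeasure α P M)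
    (ε : (Fin N → ℤ) → (Fin N → ℤ) → Ω → ℂ)
    (hε : ∀ J K, HFSS.IsStableIntegral α P M
      (fun x => conj (HFSS.hatPsiTensor α ψ J K x)) (ε J K)) :
    ∃ Ωstar : Set Ω, MeasurableSet Ωstar ∧ P Ωstar = 1 ∧
      ∀ η : ℝ, 0 < η → ∃ C : Ω → ℝ, Measurable C ∧ (∀ ω, 0 < C ω) ∧
        (α < 1 → ∀ ω ∈ Ωstar, ∀ J K : Fin N → ℤ,
          ‖ε J K ω‖ ≤ C ω * ∏ l, (1 + |(J l : ℝ)|) ^ (1 / α + η)) ∧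
        (1 ≤ α → ∀ ω ∈ Ωstar, ∀ J K : Fin N → ℤ,
          ‖ε J K ω‖ ≤ C ω * ∏ l, ((1 + |(J l : ℝ)|) ^ (1 / α + η) *
            √(Real.log (2 + |(J l : ℝ)|)) * √(Real.log (2 + |(K l : ℝ)|)))) := by
  have hmeas : ∀ i : (Fin N → ℤ) × (Fin N → ℤ), Measurable (ε i.1 i.2) := fun i =>
    (hε i.1 i.2).measurable
  have hpow : ∀ (j : ℤ) {η η' : ℝ}, η ≤ η' →
      (1 + |(j : ℝ)|) ^ (1 / α + η) ≤ (1 + |(j : ℝ)|) ^ (1 / α + η') := fun j η η' h =>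
    Real.rpow_le_rpow_of_exponent_le (by linarith [abs_nonneg (j : ℝ)]) (by linarith)
  rcases lt_or_ge α 1 with hα1 | hα1
  · obtain ⟨s, hs, hP, h⟩ := HFSS.exists_measurable_bound (P := P) hmeas
      (W := fun η i => ∏ l, (1 + |(i.1 l : ℝ)|) ^ (1 / α + η)) (fun η i => by positivity)
      (fun i η η' hη => Finset.prod_le_prod (fun l _ => by positivity) fun l _ => hpow _ hη)
      fun η hη => HFSS.ae_exists_bound_of_lt_one hα0 hα1 hM hε hη
    refine ⟨s, hs, hP, fun η hη => ?_⟩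
    obtain ⟨C, hCm, hC0, hC⟩ := h η hη
    exact ⟨C, hCm, hC0, fun _ ω hω J K => hC ω hω (J, K), fun h => absurd hα1 h.not_gt⟩
  · obtain ⟨s, hs, hP, h⟩ := HFSS.exists_measurable_bound (P := P) hmeas
      (W := fun η i => ∏ l, ((1 + |(i.1 l : ℝ)|) ^ (1 / α + η) *
        √(Real.log (2 + |(i.1 l : ℝ)|)) * √(Real.log (2 + |(i.2 l : ℝ)|))))
      (fun η i => Finset.prod_pos fun l _ => by
        have h1 := Real.sqrt_pos.2 (HFSS.log_two_add_abs_pos (i.1 l))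
        have h2 := Real.sqrt_pos.2 (HFSS.log_two_add_abs_pos (i.2 l))
        positivity)
      (fun i η η' hη => Finset.prod_le_prod (fun l _ => by positivity) fun l _ => by
        have := hpow (i.1 l) hη
        gcongr)
      fun η hη => HFSS.ae_exists_bound_of_lt_two hα0 hα2 hM hε hη
    refine ⟨s, hs, hP, fun η hη => ?_⟩
    obtain ⟨C, hCm, hC0, hC⟩ := h η hη
    exact ⟨C, hCm, hC0, fun h => absurd h hα1.not_gt, fun _ ω hω J K => hC ω hω (J, K)⟩
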